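/- Let $\ell,T>0$. Let $\rho,\mu\in H^2(0,\ell)$, $r,\kappa\in H^4(0,\ell)$ and $g\in H^3(0,T)$ satisfy $$0<\rho_0\le\rho\le\rho_1,\quad 0\le\mu_0\le\mu\le\mu_1,\quad 0<r_0\le r\le r_1,\quad 0<\kappa_0\le\kappa\le\kappa_1\ \text{ on }(0,\ell),\qquad g(0)=g'(0)=g''(0)=0,$$ with constants $\rho_0,\dots,\kappa_1$. Put $\mathcal V_1^2(0,\ell)=\{v\in H^2(0,\ell): v(0)=v_x(0)=0\}$, with the norm of $H^2(0,\ell)$, and write $(\cdot,\cdot)$ for the inner product of $L^2(0,\ell)$. Consider the problem $$\rho u_{tt}+\mu u_t+(ru_{xx})_{xx}+(\kappa u_{xxt})_{xx}=0\ \text{ in }(0,\ell)\times(0,T),$$ $$u(x,0)=u_t(x,0)=0,\quad u(0,t)=u_x(0,t)=0,\quad [ru_{xx}+\kappa u_{xxt}]_{x=\ell}=0,\quad -[(ru_{xx}+\kappa u_{xxt})_x]_{x=\ell}=g(t).$$ A weak solution is a function $u\in L^2(0,T;\mathcal V_1^2(0,\ell))$ with $u_t\in L^2(0,T;\mathcal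 V_1^2(0,\ell))$ and $u_{tt}\in L^2(0,T;L^2(0,\ell))$ such that $u(0)=0$, $u_t(0)=0$ and, for a.e. $t\in(0,T)$, $$(\rho u_{tt}(t),v)+(\mu u_t(t),v)+(ru_{xx}(t),v_{xx})+(\kappa u_{xxt}(t),v_{xx})=g(t)v(\ell)\qquad\text{for all }v\in\mathcal V_1^2(0,\ell).$$ Then a weak solution exists, and every weak solution $u$ satisfies $$u\in H^1(0,T;H^6(0,\ell)),\quad u_{tt}\in L^2(0,T;H^4(0,\ell)),\quad u_{ttt}\in L^2(0,T;\mathcal V_1^2(0,\ell)),\quad u_{tttt}\in L^2(0,T;L^2(0,\ell)),$$ and $$\|u_{tttt}\|^2_{L^2(0,T;L^2(0,\ell))}\le\frac{\kappa_0C_5^2}{4\rho_0}\,\exp(C_5^2T)\,\|g\|^2_{H^3(0,T)},$$ where $$C_5^2=\frac{2}{\kappa_0}\max\left(\frac{2(1+T)(\ell^3+3)}{3\kappa_0},\ \frac{\kappa_0\ell^3}{2(\ell^3+3)}+2r_1+\frac{2Tr_1^2(\ell^3+3)}{3\kappa_0}\right)$$ and $\|\cdot\|_{H^3(0,T)}$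 is the standard norm, $\|g\|^2_{H^3(0,T)}=\sum_{j=0}^3\|g^{(j)}\|^2_{L^2(0,T)}$. -/

import Mathlib

open MeasureTheory Set

noncomputable section

namespace Beam

/-- Test functions on the interval `(0, L)`: smooth, with compact support inside `(0, L)`. -/
def IsTest (L : ℝ) (φ : ℝ → ℝ) : Prop :=
  ContDiff ℝ (⊤ : ℕ∞) φ ∧ HasCompactSupport φ ∧ tsupport φ ⊆ Ioo 0 L

/-- Lebesgue measure on the interval `(0, L)`. -/
abbrev vol (L : ℝ) : Measure ℝ := volume.restrict (Ioo 0 L)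

/-- The real space `L²(0, L)`. -/
abbrev L2 (L : ℝ) : Type := Lp ℝ 2 (vol L)

/-- `f'` is the weak derivative of order `k` of `f` on `(0, L)`. It is used with `E = ℝ` (weak
derivatives in space, or in time for the scalar input) and with `E = L²(0, ℓ)` (weak time
derivatives). -/
def HasWeakDeriv {E : Type} [NormedAddCommGroup E] [NormedSpace ℝ E]
    (k : ℕ) (L : ℝ) (f f' : ℝ → E) : Prop :=
  ∀ φ : ℝ → ℝ, IsTest L φ →
    ∫ s, iteratedDeriv k φ s • f s ∂(vol L) = (-1 : ℝ) ^ k • ∫ s, φ s • f' s ∂(vol L)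

/-- The product of an `L²` function with a derivative of a test function is integrable. -/
theorem integrable_test_smul {L : ℝ} {φ : ℝ → ℝ} (hφ : IsTest L φ) (k : ℕ) (f : L2 L) :
    Integrable (fun s => iteratedDeriv k φ s • f s) (vol L) := by
  have hcont : Continuous (iteratedDeriv k φ) :=
    hφ.1.continuous_iteratedDeriv k (by exact_mod_cast le_top)
  have hf : Integrable f (vol L) := (Lp.memLp f).integrable (by norm_num)
  have hsupp : HasCompactSupport (iteratedDeriv k φ) := by
    induction k with
    | zero => simpa [iteratedDeriv_zero] using hφ.2.1
    | succ n ih =>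
      rw [iteratedDeriv_succ]
      exact (ih (hφ.1.continuous_iteratedDeriv n (by exact_mod_cast le_top))).deriv
  obtain ⟨C, hC⟩ := hcont.bounded_above_of_compact_support hsupp
  exact hf.bdd_smul C hcont.aestronglyMeasurable (Filter.Eventually.of_forall hC)

/-- The Sobolev space `H^m(0, L)`: tuples `(v, v', …, v^(m))` of `L²(0, L)` functions in which the
`j`-th entry is the weak derivative of order `j` of the entry `0`. Its norm, inherited from the
`ℓ²` product, is the standard one, `‖v‖² = ∑_{j ≤ m} ‖v^(j)‖²_{L²}`. -/
def sobolev (m : ℕ) (L : ℝ) : Submodule ℝ (PiLp 2 fun _ : Fin (m + 1) => L2 L) where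
  carrier := {v | ∀ j : Fin (m + 1), HasWeakDeriv (j : ℕ) L (v 0) (v j)}
  zero_mem' := by
    intro j φ hφ
    have h0 : (((0 : L2 L) : ℝ → ℝ)) =ᵐ[vol L] 0 := Lp.coeFn_zero ℝ 2 (vol L)
    have h1 : ∀ ψ : ℝ → ℝ, ∫ s, ψ s • ((0 : L2 L) : ℝ → ℝ) s ∂(vol L) = 0 := by
      intro ψ
      rw [integral_congr_ae (g := fun _ => (0 : ℝ)), integral_zero]
      filter_upwards [h0] with s hs
      rw [hs, Pi.zero_apply, smul_zero]
    simp only [PiLp.zero_apply, h1, smul_zero]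
  add_mem' := by
    intro v w hv hw j φ hφ
    have key : ∀ (k : ℕ) (a b : L2 L),
        ∫ s, iteratedDeriv k φ s • ((a + b : L2 L) : ℝ → ℝ) s ∂(vol L)
          = ∫ s, iteratedDeriv k φ s • a s ∂(vol L)
            + ∫ s, iteratedDeriv k φ s • b s ∂(vol L) := by
      intro k a b
      rw [← integral_add (integrable_test_smul hφ k a) (integrable_test_smul hφ k b)]
      refine integral_congr_ae ?_
      filter_upwards [Lp.coeFn_add a b] with s hs
      rw [hs, Pi.add_apply, smul_add]
    have key0 := key 0 (v j) (w j)
    simp only [iteratedDeriv_zero] at key0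
    rw [PiLp.add_apply, PiLp.add_apply, key, key0, smul_add, hv j φ hφ, hw j φ hφ]
  smul_mem' := by
    intro c v hv j φ hφ
    have key : ∀ (ψ : ℝ → ℝ) (a : L2 L),
        ∫ s, ψ s • ((c • a : L2 L) : ℝ → ℝ) s ∂(vol L) = c * ∫ s, ψ s • a s ∂(vol L) := by
      intro ψ a
      rw [← integral_const_mul]
      refine integral_congr_ae ?_
      filter_upwards [Lp.coeFn_smul c a] with s hs
      rw [hs, Pi.smul_apply, smul_eq_mul, smul_eq_mul, smul_eq_mul]
      ring
    rw [PiLp.smul_apply, PiLp.smul_apply, key, key, hv j φ hφ, smul_eq_mul, smul_eq_mul]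
    ring

/-- `H^m(0, L)` as a type. -/
abbrev H (m : ℕ) (L : ℝ) : Type := ↥(sobolev m L)

/-- The weak derivative of order `j` of an element of `H^m(0, L)`; `dx v 0` is `v` itself. -/
def dx {m : ℕ} {L : ℝ} (v : H m L) (j : Fin (m + 1)) : L2 L := v.1 j

/-- `f(s) = a` for the representative of `f` that is continuous on `[0, L]`. -/
def HasValueAt {E : Type} [NormedAddCommGroup E] (L : ℝ) (f : ℝ → E) (s : ℝ) (a : E) : Prop :=
  ∃ c : ℝ → E, ContinuousOn c (Icc 0 L) ∧ f =ᵐ[vol L] c ∧ c s = a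

/-- The space `V_1²(0, ℓ) = {v ∈ H²(0, ℓ) : v(0) = v_x(0) = 0}`, with the norm of `H²(0, ℓ)`. -/
def V12 (ℓ : ℝ) : Set (H 2 ℓ) :=
  {v | HasValueAt ℓ (dx v 0) 0 0 ∧ HasValueAt ℓ (dx v 1) 0 0}

/-- `w ∈ L²(0, T; H^m(0, ℓ))`, for a function `w` with values in `L²(0, ℓ)`. -/
def MemL2H (T : ℝ) (m : ℕ) {ℓ : ℝ} (w : ℝ → L2 ℓ) : Prop :=
  ∃ W : ℝ → H m ℓ, MemLp W 2 (vol T) ∧ ∀ᵐ t ∂(vol T), dx (W t) 0 = w t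

/-- `W ∈ L²(0, T; V_1²(0, ℓ))`, for a function `W` with values in `H²(0, ℓ)`. -/
def InL2V (T : ℝ) {ℓ : ℝ} (W : ℝ → H 2 ℓ) : Prop :=
  MemLp W 2 (vol T) ∧ ∀ᵐ t ∂(vol T), W t ∈ V12 ℓ

/-- `w ∈ L²(0, T; V_1²(0, ℓ))`, for a function `w` with values in `L²(0, ℓ)`. -/
def MemL2V (T : ℝ) {ℓ : ℝ} (w : ℝ → L2 ℓ) : Prop :=
  ∃ W : ℝ → H 2 ℓ, InL2V T W ∧ ∀ᵐ t ∂(vol T), dx (W t) 0 = w t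

/-- `u` is a weak solution on `(0, ℓ) × (0, T)` of
`ρ u_tt + μ u_t + (r u_xx)_xx + (κ u_xxt)_xx = 0`, `u = u_t = 0` at `t = 0`, `u = u_x = 0` at
`x = 0`, `r u_xx + κ u_xxt = 0` and `-(r u_xx + κ u_xxt)_x = g` at `x = ℓ`.
Here `ut` is `u_t` and `utt` is `u_tt`. -/
def IsWeakSolution (ℓ T : ℝ) (ρ μ r κ g : ℝ → ℝ) (u : ℝ → H 2 ℓ) : Prop :=
  InL2V T u ∧
  ∃ (ut : ℝ → H 2 ℓ) (utt : ℝ → L2 ℓ),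
    InL2V T ut ∧ HasWeakDeriv 1 T (fun t => dx (u t) 0) (fun t => dx (ut t) 0) ∧
    MemLp utt 2 (vol T) ∧ HasWeakDeriv 1 T (fun t => dx (ut t) 0) utt ∧
    (∀ᵐ t ∂(vol T), ∀ v ∈ V12 ℓ, ∀ vℓ : ℝ, HasValueAt ℓ (dx v 0) ℓ vℓ →
      ∫ x, ρ x * utt t x * dx v 0 x ∂(vol ℓ)
        + ∫ x, μ x * dx (ut t) 0 x * dx v 0 x ∂(vol ℓ)
        + ∫ x, r x * dx (u t) 2 x * dx v 2 x ∂(vol ℓ)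
        + ∫ x, κ x * dx (ut t) 2 x * dx v 2 x ∂(vol ℓ) = g t * vℓ) ∧
    HasValueAt T (fun t => dx (u t) 0) 0 0 ∧
    HasValueAt T (fun t => dx (ut t) 0) 0 0

/-- The constant `C_5²`. -/
def C5sq (ℓ T r₁ κ₀ : ℝ) : ℝ :=
  2 / κ₀ * max (2 * (1 + T) * (ℓ ^ 3 + 3) / (3 * κ₀))
    (κ₀ * ℓ ^ 3 / (2 * (ℓ ^ 3 + 3)) + 2 * r₁ + 2 * T * r₁ ^ 2 * (ℓ ^ 3 + 3) / (3 * κ₀))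

end Beam

end

/-! Everything is reduced to an evolution equation in L²(0, ℓ). A function v of V_1² is determined
by v_xx: v = S v_xx, where S = `dprim` is the twofold primitive from 0, and v(ℓ) = ⟪e, v_xx⟫ with
e(x) = ℓ - x (`tipL`). With f = u_xx the weak formulation becomes S*(ρ S f'' + μ S f') + r f + κ f'
= g e (`variational_iff`).

Existence. The vanishing data at t = 0 of u and of g allow all time derivatives to be written as
iterated primitives. The unknown is z = f'''', in the equation differentiated twice in time, with γ
= g''': S*(ρ S z + μ S ∫z) + r ∬z + κ ∫z = (∫γ) e. The operator S*ρS in front of z is nonnegative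
but not coercive; the damping κ supplies the coercivity. Solvability follows by duality: with J = ∫
in time and A the operator on the left, testing with J*ψ gives κ₀‖J*ψ‖ ≤ ‖A*ψ‖, hence the range of A
contains that of J (`exists_apply_eq_of_adjoint_bound`, `exists_integrated_solution`). Integrating
twice in time yields a weak solution.

Uniqueness. The difference of two weak solutions, tested with its own u_t, has nonnegative energy
terms and a coercive κ-term (`ae_eq_zero_of_homogeneous`). Every weak solution is therefore S
applied to the fourfold primitive of z, and u_ttt = S∫z, u_tttt = Sz have the claimed regularity.

Space regularity. Division by κ turns the equation into a linear ODE in time, f' + (r/κ) f = q,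
whose right-hand side contains S*(ρ S f'') and S*(μ S f'). Since S and S* each gain two derivatives,
and ρ, μ ∈ H², r, κ ∈ H⁴, q is continuous into H⁴. Solving the ODE in H⁴ and comparing in L² gives
f, f' ∈ H⁴ (`exists_regular_solution`), so u, u_t ∈ H⁶; the differentiated equation then gives f'' ∈
H⁴.

The bound. The equation for z is tested with z itself, the terms in r and g are integrated by parts
in time, and Gronwall's inequality with rate C_5² is applied to ∫‖f'''‖² (`energy_estimate`). -/

noncomputable section

set_option linter.unusedSectionVars false

namespace Beam

open scoped InnerProductSpace ENNReal

/-! ### Primitives of vector-valued integrable functions: product rule and bounds. -/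

section Primitive

variable {E F G : Type*} [NormedAddCommGroup E] [NormedSpace ℝ E]
  [NormedAddCommGroup F] [NormedSpace ℝ F] [NormedAddCommGroup G] [NormedSpace ℝ G]

/-- The primitive from `0` of a function on `(0, L)`, extended by zero outside. -/
def prim (L : ℝ) (f : ℝ → E) (t : ℝ) : E := ∫ s in (0 : ℝ)..t, (Ioo 0 L).indicator f s

theorem integrable_indicator_Ioo {L : ℝ} {f : ℝ → E} (hf : Integrable f (vol L)) :
    Integrable ((Ioo 0 L).indicator f) :=
  (integrable_indicator_iff measurableSet_Ioo).2 hf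

theorem continuous_prim {L : ℝ} {f : ℝ → E} (hf : Integrable f (vol L)) :
    Continuous (prim L f) :=
  (integrable_indicator_Ioo hf).continuous_primitive 0

theorem prim_congr {L : ℝ} {f g : ℝ → E} (h : f =ᵐ[vol L] g) : prim L f = prim L g := by
  funext t
  have h' : (Ioo 0 L).indicator f =ᵐ[volume] (Ioo 0 L).indicator g :=
    (ae_eq_restrict_iff_indicator_ae_eq measurableSet_Ioo).1 h
  exact intervalIntegral.integral_congr_ae (h'.mono fun x hx _ => hx)

@[simp]
theorem prim_at_zero (L : ℝ) (f : ℝ → E) : prim L f 0 = 0 := by simp [prim]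

theorem prim_add {L : ℝ} {f g : ℝ → E} (hf : Integrable f (vol L)) (hg : Integrable g (vol L))
    (t : ℝ) : prim L (fun s => f s + g s) t = prim L f t + prim L g t := by
  unfold prim
  rw [← intervalIntegral.integral_add (integrable_indicator_Ioo hf).intervalIntegrable
    (integrable_indicator_Ioo hg).intervalIntegrable]
  congr 1
  funext s
  exact congrFun (indicator_add (Ioo 0 L) f g) s

theorem prim_smul {L : ℝ} (c : ℝ) (f : ℝ → E) (t : ℝ) :
    prim L (fun s => c • f s) t = c • prim L f t := by
  unfold prim
  rw [← intervalIntegral.integral_smul]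
  congr 1
  funext s
  exact congrFun (indicator_const_smul (Ioo 0 L) c f) s

theorem prim_sub {L : ℝ} {f g : ℝ → E} (hf : Integrable f (vol L)) (hg : Integrable g (vol L))
    (t : ℝ) : prim L (fun s => f s - g s) t = prim L f t - prim L g t := by
  have hg' : Integrable (fun s => (-1 : ℝ) • g s) (vol L) := hg.smul (-1 : ℝ)
  have h := prim_add hf hg' t
  rw [prim_smul] at h
  simpa [sub_eq_add_neg] using h

theorem map_prim [CompleteSpace E] [CompleteSpace F] {L : ℝ} (A : E →L[ℝ] F) {f : ℝ → E}
    (hf : Integrable f (vol L)) (t : ℝ) : A (prim L f t) = prim L (fun s => A (f s)) t := by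
  unfold prim
  rw [← A.intervalIntegral_comp_comm (integrable_indicator_Ioo hf).intervalIntegrable]
  congr 1
  funext s
  by_cases hs : s ∈ Ioo 0 L <;> simp [hs]

theorem prim_eq_setIntegral {L : ℝ} {t : ℝ} (ht : t ∈ Icc 0 L) (f : ℝ → E) :
    prim L f t = ∫ s in Ioo 0 t, f s := by
  unfold prim
  rw [intervalIntegral.integral_of_le ht.1, ← restrict_Ioo_eq_restrict_Ioc]
  refine setIntegral_congr_fun measurableSet_Ioo fun s hs => ?_
  exact indicator_of_mem (s := Ioo 0 L) ⟨hs.1, hs.2.trans_le ht.2⟩ f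

theorem prim_right {L : ℝ} (hL : 0 ≤ L) (f : ℝ → E) : prim L f L = ∫ s, f s ∂(vol L) :=
  prim_eq_setIntegral ⟨hL, le_rfl⟩ f

theorem integrable_vol_of_continuous {L : ℝ} {f : ℝ → E} (hf : Continuous f) :
    Integrable f (vol L) :=
  (hf.integrableOn_Icc (a := 0) (b := L)).mono_set Ioo_subset_Icc_self

theorem memLp_vol_of_continuous {L : ℝ} {f : ℝ → E} (hf : Continuous f) :
    MemLp f 2 (vol L) := by
  obtain ⟨C, hC⟩ := (isCompact_Icc (a := (0 : ℝ)) (b := L)).exists_bound_of_continuousOn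
    hf.continuousOn
  refine MemLp.of_bound (integrable_vol_of_continuous hf).1 C ?_
  exact (ae_restrict_mem measurableSet_Ioo).mono fun x hx => hC x (Ioo_subset_Icc_self hx)

theorem integrable_vol_of_memLp {L : ℝ} {f : ℝ → E} (hf : MemLp f 2 (vol L)) :
    Integrable f (vol L) := hf.integrable (by norm_num)

/-- The product rule for primitives, under a bounded bilinear map. -/
theorem bilin_integral_mul_integral [CompleteSpace E] [CompleteSpace F] [CompleteSpace G]
    (B : E →L[ℝ] F →L[ℝ] G) {f : ℝ → E} {g : ℝ → F} (hf : Integrable f) (hg : Integrable g)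
    {t : ℝ} (ht : 0 ≤ t) :
    B (∫ s in (0 : ℝ)..t, f s) (∫ s in (0 : ℝ)..t, g s) =
      (∫ s in (0 : ℝ)..t, B (f s) (∫ σ in (0 : ℝ)..s, g σ)) +
        ∫ s in (0 : ℝ)..t, B (∫ σ in (0 : ℝ)..s, f σ) (g s) := by
  set ν : Measure ℝ := volume.restrict (Ioc 0 t) with hν
  have hf' : Integrable f ν := hf.restrict
  have hg' : Integrable g ν := hg.restrict
  have hH : Integrable (fun z : ℝ × ℝ => B (f z.1) (g z.2)) (ν.prod ν) :=
    Integrable.op_fst_snd (op := fun x y => B x y) B.continuous₂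
      ⟨‖B‖, fun x y => B.le_opNorm₂ x y⟩ hf' hg'
  have hS : MeasurableSet {z : ℝ × ℝ | z.2 ≤ z.1} := measurableSet_le measurable_snd measurable_fst
  -- Fubini on the square (0, t]²: the triangle σ ≤ s gives one term of the product rule, its
  -- complement the other.
  have h1 : ∫ z in {z : ℝ × ℝ | z.2 ≤ z.1}, B (f z.1) (g z.2) ∂(ν.prod ν)
      = ∫ s in (0 : ℝ)..t, B (f s) (∫ σ in (0 : ℝ)..s, g σ) := by
    rw [← integral_indicator hS, integral_prod _ (hH.indicator hS),
      intervalIntegral.integral_of_le ht]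
    refine setIntegral_congr_fun measurableSet_Ioc fun s hs => ?_
    have : ∀ σ, {z : ℝ × ℝ | z.2 ≤ z.1}.indicator (fun z => B (f z.1) (g z.2)) (s, σ)
        = (Iic s).indicator (fun σ => B (f s) (g σ)) σ := by
      intro σ; simp [indicator_apply]
    simp only [this]
    rw [integral_indicator measurableSet_Iic, hν, Measure.restrict_restrict measurableSet_Iic,
      show Iic s ∩ Ioc 0 t = Ioc 0 s by
        ext σ; simp only [mem_inter_iff, mem_Iic, mem_Ioc]
        constructor
        · rintro ⟨a, b, c⟩; exact ⟨b, a⟩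
        · rintro ⟨a, b⟩; exact ⟨b, a, b.trans hs.2⟩,
      (B (f s)).integral_comp_comm hg.restrict, intervalIntegral.integral_of_le hs.1.le]
  have h2 : ∫ z in {z : ℝ × ℝ | z.2 ≤ z.1}ᶜ, B (f z.1) (g z.2) ∂(ν.prod ν)
      = ∫ s in (0 : ℝ)..t, B (∫ σ in (0 : ℝ)..s, f σ) (g s) := by
    rw [← integral_indicator hS.compl, integral_prod_symm _ (hH.indicator hS.compl),
      intervalIntegral.integral_of_le ht]
    refine setIntegral_congr_fun measurableSet_Ioc fun s hs => ?_
    have : ∀ σ, {z : ℝ × ℝ | z.2 ≤ z.1}ᶜ.indicator (fun z => B (f z.1) (g z.2)) (σ, s)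
        = (Iio s).indicator (fun σ => B.flip (g s) (f σ)) σ := by
      intro σ; simp [indicator_apply]
    simp only [this]
    rw [integral_indicator measurableSet_Iio, hν, Measure.restrict_restrict measurableSet_Iio,
      show Iio s ∩ Ioc 0 t = Ioo 0 s by
        ext σ; simp only [mem_inter_iff, mem_Iio, mem_Ioc, mem_Ioo]
        constructor
        · rintro ⟨a, b, c⟩; exact ⟨b, a⟩
        · rintro ⟨a, b⟩; exact ⟨b, a, (b.trans_le hs.2).le⟩,
      (B.flip (g s)).integral_comp_comm hf.restrict, intervalIntegral.integral_of_le hs.1.le,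
      ← restrict_Ioo_eq_restrict_Ioc]
    rfl
  rw [← h1, ← h2, integral_add_compl hS hH, integral_prod_bilin B hf' hg',
    intervalIntegral.integral_of_le ht, intervalIntegral.integral_of_le ht]

theorem integrable_bilin_left [CompleteSpace E] [CompleteSpace F] {L : ℝ}
    (B : E →L[ℝ] F →L[ℝ] G) {f : ℝ → E} {c : ℝ → F}
    (hf : Integrable f (vol L)) (hc : Continuous c) :
    Integrable (fun s => B (f s) (c s)) (vol L) := by
  obtain ⟨C, hC⟩ := (isCompact_Icc (a := (0 : ℝ)) (b := L)).exists_bound_of_continuousOn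
    hc.continuousOn
  exact B.integrable_of_bilin_of_bdd_right C hf (integrable_vol_of_continuous hc).1
    ((ae_restrict_mem measurableSet_Ioo).mono fun x hx => hC x (Ioo_subset_Icc_self hx))

theorem integrable_bilin_right [CompleteSpace E] [CompleteSpace F] {L : ℝ}
    (B : E →L[ℝ] F →L[ℝ] G) {f : ℝ → F} {c : ℝ → E}
    (hc : Continuous c) (hf : Integrable f (vol L)) :
    Integrable (fun s => B (c s) (f s)) (vol L) :=
  integrable_bilin_left B.flip hf hc

theorem bilin_prim_prim [CompleteSpace E] [CompleteSpace F] [CompleteSpace G] {L : ℝ}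
    (B : E →L[ℝ] F →L[ℝ] G) {f : ℝ → E} {g : ℝ → F}
    (hf : Integrable f (vol L)) (hg : Integrable g (vol L)) {t : ℝ} (ht : 0 ≤ t) :
    B (prim L f t) (prim L g t) =
      prim L (fun s => B (f s) (prim L g s)) t + prim L (fun s => B (prim L f s) (g s)) t := by
  have h := bilin_integral_mul_integral B (integrable_indicator_Ioo hf)
    (integrable_indicator_Ioo hg) ht
  unfold prim
  rw [h]
  congr 2 <;> funext s <;> by_cases hs : s ∈ Ioo 0 L <;> simp [hs]

theorem bilin_add_prim [CompleteSpace E] [CompleteSpace F] [CompleteSpace G] {L : ℝ}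
    (B : E →L[ℝ] F →L[ℝ] G) (a : E) (b : F) {f : ℝ → E} {g : ℝ → F}
    (hf : Integrable f (vol L)) (hg : Integrable g (vol L)) {t : ℝ} (ht : 0 ≤ t) :
    B (a + prim L f t) (b + prim L g t) = B a b +
      prim L (fun s => B (f s) (b + prim L g s) + B (a + prim L f s) (g s)) t := by
  have i1 : Integrable (fun s => B (f s) (prim L g s)) (vol L) :=
    integrable_bilin_left B hf (continuous_prim hg)
  have i2 : Integrable (fun s => B (prim L f s) (g s)) (vol L) :=
    integrable_bilin_right B (continuous_prim hf) hg
  have i3 : Integrable (fun s => B (f s) b) (vol L) := (B.flip b).integrable_comp hf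
  have i4 : Integrable (fun s => B a (g s)) (vol L) := (B a).integrable_comp hg
  have h3 : B (prim L f t) b = prim L (fun s => B (f s) b) t := map_prim (B.flip b) hf t
  have h4 : B a (prim L g t) = prim L (fun s => B a (g s)) t := map_prim (B a) hg t
  have i13 : Integrable (fun s => B (f s) b + B (f s) (prim L g s)) (vol L) := i3.add i1
  have i24 : Integrable (fun s => B a (g s) + B (prim L f s) (g s)) (vol L) := i4.add i2
  simp only [map_add, add_apply]
  rw [prim_add i13 i24, prim_add i3 i1, prim_add i4 i2, h3, h4, bilin_prim_prim B hf hg ht]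
  abel

/-- Cauchy–Schwarz, obtained by expanding the nonnegative variance ∫(‖f‖ - m/t)² with m = ∫‖f‖. -/
theorem norm_prim_sq_le {L : ℝ} {f : ℝ → E} (hf : MemLp f 2 (vol L)) {t : ℝ} (ht : t ∈ Icc 0 L) :
    ‖prim L f t‖ ^ 2 ≤ t * ∫ s in Ioo 0 t, ‖f s‖ ^ 2 := by
  have hsub : vol t ≤ vol L := Measure.restrict_mono (Ioo_subset_Ioo le_rfl ht.2) le_rfl
  have hf' : MemLp f 2 (vol t) := hf.mono_measure hsub
  have hi : Integrable (fun s => ‖f s‖) (vol t) := (integrable_vol_of_memLp hf').norm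
  have hi2 : Integrable (fun s => ‖f s‖ ^ 2) (vol t) := by
    simpa using hf'.integrable_norm_pow (p := 2) (by norm_num)
  have hm : ‖prim L f t‖ ≤ ∫ s in Ioo 0 t, ‖f s‖ := by
    rw [prim_eq_setIntegral ht]; exact norm_integral_le_integral_norm _
  set m := ∫ s in Ioo 0 t, ‖f s‖ with hmdef
  rcases ht.1.eq_or_lt with h0 | h0
  · subst h0; simp
  have key : 0 ≤ ∫ s in Ioo 0 t, (‖f s‖ - m / t) ^ 2 :=
    integral_nonneg fun s => sq_nonneg _
  have e : ∀ s, (‖f s‖ - m / t) ^ 2 = ‖f s‖ ^ 2 - 2 * (m / t) * ‖f s‖ + (m / t) ^ 2 := by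
    intro s; ring
  simp only [e] at key
  have i1 : Integrable (fun s => 2 * (m / t) * ‖f s‖) (vol t) := hi.const_mul _
  have i2 : Integrable (fun s => ‖f s‖ ^ 2 - 2 * (m / t) * ‖f s‖) (vol t) := hi2.sub i1
  rw [integral_add i2 (integrable_const _), integral_sub hi2 i1, integral_const_mul,
    ← hmdef] at key
  simp only [integral_const, smul_eq_mul, Measure.real, Measure.restrict_apply MeasurableSet.univ,
    univ_inter, Real.volume_Ioo, sub_zero, ENNReal.toReal_ofReal ht.1] at key
  have h2 : ‖prim L f t‖ ^ 2 ≤ m ^ 2 := pow_le_pow_left₀ (norm_nonneg _) hm 2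
  have h3 : m ^ 2 = t * (m ^ 2 / t) := by field_simp
  rw [h3] at h2
  refine h2.trans (mul_le_mul_of_nonneg_left ?_ ht.1)
  have : t * (m / t) ^ 2 = m ^ 2 / t := by field_simp
  have : 2 * (m / t) * m = 2 * (m ^ 2 / t) := by field_simp
  linarith

theorem norm_prim_le {L : ℝ} (hL : 0 < L) {f : ℝ → E} (hf : MemLp f 2 (vol L)) {t : ℝ}
    (ht : t ∈ Icc 0 L) : ‖prim L f t‖ ≤ Real.sqrt L * Real.sqrt (∫ s, ‖f s‖ ^ 2 ∂(vol L)) := by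
  rw [← Real.sqrt_mul hL.le]
  refine Real.le_sqrt_of_sq_le ((norm_prim_sq_le hf ht).trans ?_)
  refine mul_le_mul ht.2 ?_ (integral_nonneg fun s => sq_nonneg _) hL.le
  refine setIntegral_mono_set ?_ (Filter.Eventually.of_forall fun s => sq_nonneg _)
    (Ioo_subset_Ioo le_rfl ht.2).eventuallyLE
  simpa [IntegrableOn] using hf.integrable_norm_pow (p := 2) (by norm_num)

end Primitive

/-! ### Weak derivatives in one variable and continuous representatives. -/

section WeakDeriv

theorem IsTest.continuous {L : ℝ} {φ : ℝ → ℝ} (hφ : IsTest L φ) : Continuous φ := hφ.1.continuous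

theorem IsTest.contDiff_deriv {L : ℝ} {φ : ℝ → ℝ} (hφ : IsTest L φ) :
    ContDiff ℝ (⊤ : ℕ∞) (deriv φ) := by
  have h := hφ.1
  rw [show ((⊤ : ℕ∞) : WithTop ℕ∞) = ((⊤ : ℕ∞) : WithTop ℕ∞) + 1 by rfl] at h
  exact (contDiff_succ_iff_deriv.1 h).2.2

theorem IsTest.deriv {L : ℝ} {φ : ℝ → ℝ} (hφ : IsTest L φ) : IsTest L (deriv φ) :=
  ⟨hφ.contDiff_deriv, hφ.2.1.deriv, fun _ hx => hφ.2.2 (tsupport_deriv_subset hx)⟩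

theorem IsTest.eq_zero {L : ℝ} {φ : ℝ → ℝ} (hφ : IsTest L φ) {t : ℝ} (ht : t ∉ Ioo 0 L) :
    φ t = 0 := image_eq_zero_of_notMem_tsupport fun h => ht (hφ.2.2 h)

theorem IsTest.hasDerivAt {L : ℝ} {φ : ℝ → ℝ} (hφ : IsTest L φ) (t : ℝ) :
    HasDerivAt φ (_root_.deriv φ t) t :=
  (hφ.1.differentiable (by simp) t).hasDerivAt

theorem IsTest.prim_deriv {L : ℝ} {φ : ℝ → ℝ} (hφ : IsTest L φ) {t : ℝ} (ht : t ∈ Icc 0 L) :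
    prim L (_root_.deriv φ) t = φ t := by
  rw [prim_eq_setIntegral ht, restrict_Ioo_eq_restrict_Ioc, ← intervalIntegral.integral_of_le ht.1,
    intervalIntegral.integral_eq_sub_of_hasDerivAt (fun x _ => hφ.hasDerivAt x)
      (hφ.contDiff_deriv.continuous.intervalIntegrable _ _), hφ.eq_zero (t := 0) (by simp),
    sub_zero]

variable {E : Type} [NormedAddCommGroup E] [NormedSpace ℝ E]

theorem HasWeakDeriv.congr {k : ℕ} {L : ℝ} {f g f' g' : ℝ → E} (h : HasWeakDeriv k L f f')
    (hf : f =ᵐ[vol L] g) (hf' : f' =ᵐ[vol L] g') : HasWeakDeriv k L g g' := by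
  intro φ hφ
  rw [← integral_congr_ae (hf.mono fun s hs => by simp only [hs] :
      (fun s => iteratedDeriv k φ s • f s) =ᵐ[vol L] fun s => iteratedDeriv k φ s • g s),
    ← integral_congr_ae (hf'.mono fun s hs => by simp only [hs] :
      (fun s => φ s • f' s) =ᵐ[vol L] fun s => φ s • g' s)]
  exact h φ hφ

theorem integrable_smul_of_continuous [CompleteSpace E] {L : ℝ} {φ : ℝ → ℝ} (hφ : Continuous φ)
    {f : ℝ → E} (hf : Integrable f (vol L)) : Integrable (fun s => φ s • f s) (vol L) :=
  integrable_bilin_right (ContinuousLinearMap.lsmul ℝ ℝ) hφ hf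

/-- The product rule for primitives, applied to φ = ∫φ' and a + ∫f; the boundary terms vanish
because φ does at both ends. -/
theorem hasWeakDeriv_add_prim [CompleteSpace E] {L : ℝ} (hL : 0 ≤ L) (a : E) {f : ℝ → E}
    (hf : Integrable f (vol L)) : HasWeakDeriv 1 L (fun t => a + prim L f t) f := by
  intro φ hφ
  have hd : Integrable (_root_.deriv φ) (vol L) :=
    integrable_vol_of_continuous hφ.contDiff_deriv.continuous
  have h := bilin_add_prim (ContinuousLinearMap.lsmul ℝ ℝ) (0 : ℝ) a hd hf hL
  have hφ' : ∀ t ∈ Icc 0 L, 0 + prim L (_root_.deriv φ) t = φ t := fun t ht => by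
    rw [hφ.prim_deriv ht, zero_add]
  have i1 : Integrable (fun s => _root_.deriv φ s • (a + prim L f s)) (vol L) :=
    integrable_bilin_left (ContinuousLinearMap.lsmul ℝ ℝ) hd
      (continuous_const.add (continuous_prim hf))
  have i2 : Integrable (fun s => φ s • f s) (vol L) :=
    integrable_smul_of_continuous hφ.continuous hf
  rw [hφ' L ⟨hL, le_rfl⟩, hφ.eq_zero (t := L) (by simp)] at h
  simp only [ContinuousLinearMap.lsmul_apply, zero_smul, zero_add] at h
  rw [prim_right hL] at h
  rw [integral_congr_ae (g := fun s => _root_.deriv φ s • (a + prim L f s) + φ s • f s),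
    integral_add i1 i2] at h
  · rw [iteratedDeriv_one, pow_one, neg_one_smul]
    exact eq_neg_of_add_eq_zero_left h.symm
  · filter_upwards [ae_restrict_mem measurableSet_Ioo] with s hs
    rw [hφ.prim_deriv (Ioo_subset_Icc_self hs)]

theorem ae_eq_of_forall_test [CompleteSpace E] {L : ℝ} {f g : ℝ → E} (hf : Integrable f (vol L))
    (hg : Integrable g (vol L))
    (h : ∀ φ, IsTest L φ → ∫ s, φ s • f s ∂(vol L) = ∫ s, φ s • g s ∂(vol L)) :
    f =ᵐ[vol L] g := by
  have hfg : IntegrableOn (fun s => f s - g s) (Ioo 0 L) := hf.sub hg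
  have := isOpen_Ioo.ae_eq_zero_of_integral_contDiff_smul_eq_zero (μ := volume)
    hfg.locallyIntegrableOn (fun φ h1 h2 h3 => by
      have i1 := integrable_smul_of_continuous (φ := φ) h1.continuous hf
      have i2 := integrable_smul_of_continuous (φ := φ) h1.continuous hg
      rw [← setIntegral_eq_integral_of_forall_compl_eq_zero (s := Ioo 0 L)]
      · simp only [smul_sub]
        rw [integral_sub i1 i2, h φ ⟨h1, h2, h3⟩, sub_self]
      · intro x hx
        rw [image_eq_zero_of_notMem_tsupport fun h => hx (h3 h), zero_smul])
  refine (ae_restrict_iff' measurableSet_Ioo).2 (this.mono fun x hx hx' => sub_eq_zero.1 (hx hx'))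

theorem HasWeakDeriv.ae_eq [CompleteSpace E] {k : ℕ} {L : ℝ} {f f' g' : ℝ → E}
    (h : HasWeakDeriv k L f f') (h' : HasWeakDeriv k L f g') (hf' : Integrable f' (vol L))
    (hg' : Integrable g' (vol L)) : f' =ᵐ[vol L] g' := by
  refine ae_eq_of_forall_test hf' hg' fun φ hφ => ?_
  have := (h φ hφ).symm.trans (h' φ hφ)
  exact smul_right_injective E (pow_ne_zero k (by norm_num : (-1 : ℝ) ≠ 0)) this

theorem exists_isTest_integral_eq_one {L : ℝ} (hL : 0 < L) :
    ∃ χ, IsTest L χ ∧ ∫ s, χ s ∂(vol L) = 1 := by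
  let b : ContDiffBump (L / 2) := ⟨L / 8, L / 4, by positivity, by linarith⟩
  have hs : tsupport (b.normed volume) ⊆ Ioo 0 L := by
    rw [b.tsupport_normed_eq, Real.closedBall_eq_Icc]
    intro x hx
    have h1 := hx.1; have h2 := hx.2
    change L / 2 - L / 4 ≤ x at h1
    change x ≤ L / 2 + L / 4 at h2
    constructor <;> linarith
  refine ⟨b.normed volume, ⟨b.contDiff_normed, b.hasCompactSupport_normed, hs⟩, ?_⟩
  rw [setIntegral_eq_integral_of_forall_compl_eq_zero]
  · exact b.integral_normed
  · intro x hx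
    exact image_eq_zero_of_notMem_tsupport fun h => hx (hs h)

theorem IsTest.exists_Icc {L : ℝ} (hL : 0 < L) {φ : ℝ → ℝ} (hφ : IsTest L φ) :
    ∃ α β, 0 < α ∧ α < L ∧ 0 < β ∧ β < L ∧ ∀ x, φ x ≠ 0 → x ∈ Icc α β := by
  rcases (tsupport φ).eq_empty_or_nonempty with h | h
  · refine ⟨L / 2, L / 2, by linarith, by linarith, by linarith, by linarith, fun x hx => ?_⟩
    exact absurd (subset_tsupport φ hx) (h ▸ notMem_empty x)
  · have hc : IsCompact (tsupport φ) := hφ.2.1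
    have h1 := hφ.2.2 (hc.sInf_mem h)
    have h2 := hφ.2.2 (hc.sSup_mem h)
    exact ⟨_, _, h1.1, h1.2, h2.1, h2.2, fun x hx =>
      ⟨csInf_le hc.bddBelow (subset_tsupport φ hx), le_csSup hc.bddAbove (subset_tsupport φ hx)⟩⟩

/-- The primitive from 0 vanishes to the left of the support of ψ, and to the right of it because
the total integral is zero, so it has compact support in (0, L). -/
theorem IsTest.exists_deriv_eq {L : ℝ} (hL : 0 < L) {ψ : ℝ → ℝ} (hψ : IsTest L ψ)
    (h0 : ∫ s, ψ s ∂(vol L) = 0) : ∃ Ψ, IsTest L Ψ ∧ _root_.deriv Ψ = ψ := by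
  obtain ⟨α, β, hα, -, -, hβ, hsupp⟩ := hψ.exists_Icc hL
  have hd : ∀ t, HasDerivAt (fun t => ∫ s in (0 : ℝ)..t, ψ s) (ψ t) t := fun t =>
    intervalIntegral.integral_hasDerivAt_right (hψ.continuous.intervalIntegrable _ _)
      (hψ.continuous.stronglyMeasurableAtFilter _ _) hψ.continuous.continuousAt
  have hder : _root_.deriv (fun t => ∫ s in (0 : ℝ)..t, ψ s) = ψ := funext fun t => (hd t).deriv
  have hfull : ∫ s in (0 : ℝ)..L, ψ s = 0 := by
    rw [intervalIntegral.integral_of_le hL.le, ← restrict_Ioo_eq_restrict_Ioc]; exact h0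
  have hz : ∀ t, t ∉ Icc α β → ∫ s in (0 : ℝ)..t, ψ s = 0 := by
    intro t ht
    have hz' : ∀ s, s ∉ Icc α β → ψ s = 0 := fun s hs => by
      by_contra h; exact hs (hsupp s h)
    rcases lt_or_ge t α with h | h
    · rw [intervalIntegral.integral_congr (g := fun _ => (0 : ℝ))]
      · simp
      · intro s hs
        refine hz' s fun hs' => ?_
        have := hs.2.trans_lt (max_lt hα h)
        exact absurd hs'.1 (not_le.2 this)
    · have hβt : β < t := by
        by_contra h'; exact ht ⟨h, not_lt.1 h'⟩
      rw [← intervalIntegral.integral_add_adjacent_intervals (b := L)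
        (hψ.continuous.intervalIntegrable _ _) (hψ.continuous.intervalIntegrable _ _), hfull,
        zero_add, intervalIntegral.integral_congr (g := fun _ => (0 : ℝ))]
      · simp
      · intro s hs
        refine hz' s fun hs' => ?_
        have := (lt_min hβ hβt).trans_le hs.1
        exact absurd hs'.2 (not_le.2 this)
  have hts : tsupport (fun t => ∫ s in (0 : ℝ)..t, ψ s) ⊆ Icc α β := by
    refine closure_minimal (fun t ht => ?_) isClosed_Icc
    by_contra h; exact ht (hz t h)
  refine ⟨_, ⟨?_, ?_, hts.trans fun x hx => ⟨hα.trans_le hx.1, hx.2.trans_lt hβ⟩⟩, hder⟩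
  · rw [show ((⊤ : ℕ∞) : WithTop ℕ∞) = ((⊤ : ℕ∞) : WithTop ℕ∞) + 1 by rfl]
    refine contDiff_succ_iff_deriv.2 ⟨fun t => (hd t).differentiableAt, by simp, ?_⟩
    rw [hder]; exact hψ.1
  · exact HasCompactSupport.of_support_subset_isCompact isCompact_Icc
      ((subset_tsupport _).trans hts)

/-- Du Bois-Reymond: for a fixed χ of mean one, φ - (∫φ)χ has mean zero, hence is the derivative of
a test function and is orthogonal to f. The constant is therefore ∫χf. -/
theorem HasWeakDeriv.exists_ae_eq_const [CompleteSpace E] {L : ℝ} (hL : 0 < L) {f : ℝ → E}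
    (hf : Integrable f (vol L)) (h : HasWeakDeriv 1 L f 0) : ∃ a, f =ᵐ[vol L] fun _ => a := by
  obtain ⟨χ, hχ, hχ1⟩ := exists_isTest_integral_eq_one hL
  refine ⟨∫ s, χ s • f s ∂(vol L), ae_eq_of_forall_test hf (integrable_const _) fun φ hφ => ?_⟩
  set m := ∫ s, φ s ∂(vol L) with hm
  have iφ : Integrable φ (vol L) := integrable_vol_of_continuous hφ.continuous
  have iχ : Integrable χ (vol L) := integrable_vol_of_continuous hχ.continuous
  have iφf := integrable_smul_of_continuous hφ.continuous hf
  have iχf := integrable_smul_of_continuous hχ.continuous hf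
  have hψ : IsTest L (fun s => φ s - m * χ s) := by
    refine ⟨hφ.1.sub (contDiff_const.mul hχ.1), hφ.2.1.sub (hχ.2.1.mul_left), ?_⟩
    refine (tsupport_sub φ (fun s => m * χ s)).trans (union_subset hφ.2.2 ?_)
    exact (closure_mono (Function.support_mul_subset_right (fun _ => m) χ)).trans hχ.2.2
  have hψ0 : ∫ s, (φ s - m * χ s) ∂(vol L) = 0 := by
    rw [integral_sub iφ (iχ.const_mul m), integral_const_mul, hχ1, mul_one, hm, sub_self]
  obtain ⟨Ψ, hΨ, hΨ'⟩ := hψ.exists_deriv_eq hL hψ0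
  have := h Ψ hΨ
  rw [iteratedDeriv_one, hΨ'] at this
  simp only [Pi.zero_apply, smul_zero, integral_zero, sub_smul, mul_smul] at this
  have iχf' : Integrable (fun s => m • χ s • f s) (vol L) := iχf.smul m
  rw [integral_sub iφf iχf', integral_smul] at this
  rw [sub_eq_zero.1 this, integral_smul_const]

theorem HasWeakDeriv.sub [CompleteSpace E] {k : ℕ} {L : ℝ} {f g f' g' : ℝ → E}
    (h : HasWeakDeriv k L f f')
    (h' : HasWeakDeriv k L g g') (hf : Integrable f (vol L)) (hg : Integrable g (vol L))
    (hf' : Integrable f' (vol L)) (hg' : Integrable g' (vol L)) :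
    HasWeakDeriv k L (fun s => f s - g s) (fun s => f' s - g' s) := by
  intro φ hφ
  have hc : Continuous (iteratedDeriv k φ) :=
    hφ.1.continuous_iteratedDeriv k (by exact_mod_cast le_top)
  simp only [smul_sub]
  rw [integral_sub (integrable_smul_of_continuous hc hf) (integrable_smul_of_continuous hc hg),
    integral_sub (integrable_smul_of_continuous hφ.continuous hf')
      (integrable_smul_of_continuous hφ.continuous hg'), smul_sub, h φ hφ, h' φ hφ]

/-- A function with an integrable weak derivative is a primitive of it, up to a constant. -/
theorem HasWeakDeriv.exists_ae_eq_add_prim [CompleteSpace E] {L : ℝ} (hL : 0 < L) {f f' : ℝ → E}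
    (hf : Integrable f (vol L)) (hf' : Integrable f' (vol L)) (h : HasWeakDeriv 1 L f f') :
    ∃ a, f =ᵐ[vol L] fun t => a + prim L f' t := by
  have hc : Continuous fun t => (0 : E) + prim L f' t := continuous_const.add (continuous_prim hf')
  have hi := integrable_vol_of_continuous (L := L) hc
  have h2 := h.sub (hasWeakDeriv_add_prim hL.le 0 hf') hf hi hf' hf'
  obtain ⟨a, ha⟩ := (h2.congr (g' := 0) Filter.EventuallyEq.rfl
    (Filter.Eventually.of_forall fun s => sub_self _)).exists_ae_eq_const hL (hf.sub hi)
  refine ⟨a, ha.mono fun t ht => ?_⟩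
  simp only [zero_add] at ht
  exact sub_eq_iff_eq_add.1 ht

/-- Two functions continuous on [0, L] that agree almost everywhere agree at every point, so the
boundary value may be read off any continuous representative. -/
theorem HasValueAt.eq_of_ae_eq {L : ℝ} (hL : 0 < L) {f c : ℝ → E} {s : ℝ} {a : E}
    (h : HasValueAt L f s a) (hc : ContinuousOn c (Icc 0 L)) (hfc : f =ᵐ[vol L] c)
    (hs : s ∈ Icc 0 L) : c s = a := by
  obtain ⟨c', hc', hfc', rfl⟩ := h
  have h1 : c =ᵐ[vol L] c' := hfc.symm.trans hfc'
  rw [vol, restrict_Ioo_eq_restrict_Ioc, restrict_Ioc_eq_restrict_Icc] at h1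
  exact Measure.eqOn_Icc_of_ae_eq volume hL.ne h1 hc hc' hs

theorem HasWeakDeriv.ae_eq_prim [CompleteSpace E] {L : ℝ} (hL : 0 < L) {f f' : ℝ → E}
    (hf : Integrable f (vol L)) (hf' : Integrable f' (vol L)) (h : HasWeakDeriv 1 L f f')
    (h0 : HasValueAt L f 0 0) : f =ᵐ[vol L] prim L f' := by
  obtain ⟨a, ha⟩ := h.exists_ae_eq_add_prim hL hf hf'
  have := h0.eq_of_ae_eq hL (continuous_const.add (continuous_prim hf')).continuousOn ha
    ⟨le_rfl, hL.le⟩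
  have ha0 : a = 0 := by simpa using this
  simpa [ha0] using ha

theorem hasWeakDeriv_prim [CompleteSpace E] {L : ℝ} (hL : 0 ≤ L) {f : ℝ → E}
    (hf : Integrable f (vol L)) : HasWeakDeriv 1 L (prim L f) f := by
  simpa using hasWeakDeriv_add_prim hL 0 hf

theorem HasValueAt.of_continuous {L : ℝ} {f c : ℝ → E} (hc : Continuous c) (h : f =ᵐ[vol L] c)
    (s : ℝ) : HasValueAt L f s (c s) := ⟨c, hc.continuousOn, h, rfl⟩

end WeakDeriv

/-! ### Time integration on L²((0, L); E) and solvability by duality. -/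

section Operators

/-- A bounded operator whose adjoint dominates another one has the larger range. -/
theorem exists_apply_eq_of_adjoint_bound {V : Type*} [NormedAddCommGroup V] [InnerProductSpace ℝ V]
    [CompleteSpace V] (A J : V →L[ℝ] V) {c : ℝ} (hc : 0 < c)
    (h : ∀ ψ, c * ‖J.adjoint ψ‖ ≤ ‖A.adjoint ψ‖) (p : V) : ∃ z, A z = J p := by
  set A' : V →ₗ[ℝ] V := (A.adjoint : V →ₗ[ℝ] V) with hA'
  obtain ⟨s, hs⟩ := A'.rangeRestrict.exists_rightInverse_of_surjective A'.range_rangeRestrict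
  have hs' : ∀ y : A'.range, A.adjoint (s y) = y := fun y =>
    congrArg Subtype.val (LinearMap.congr_fun hs y)
  -- The functional A*ψ ↦ ⟪p, J*ψ⟫ on the range of A*, defined through a linear section `s`. The
  -- bound makes it continuous and, as `h3` shows, independent of the chosen preimage; its
  -- Hahn–Banach extension is represented by the solution z.
  let φ₀ : A'.range →ₗ[ℝ] ℝ := ((innerSL ℝ p).comp J.adjoint : V →ₗ[ℝ] ℝ) ∘ₗ s
  have hφ₀ : ∀ y, ‖φ₀ y‖ ≤ (‖p‖ / c) * ‖y‖ := by
    intro y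
    have h1 : ‖φ₀ y‖ ≤ ‖p‖ * ‖J.adjoint (s y)‖ := norm_inner_le_norm p _
    have h2 := h (s y)
    rw [hs'] at h2
    have h3 : ‖J.adjoint (s y)‖ ≤ ‖(y : V)‖ / c := by rw [le_div_iff₀ hc]; linarith
    calc ‖φ₀ y‖ ≤ ‖p‖ * ‖J.adjoint (s y)‖ := h1
      _ ≤ ‖p‖ * (‖(y : V)‖ / c) := mul_le_mul_of_nonneg_left h3 (norm_nonneg _)
      _ = (‖p‖ / c) * ‖y‖ := by rw [Submodule.coe_norm]; ring
  obtain ⟨φ, hφ, -⟩ := exists_extension_norm_eq A'.range (φ₀.mkContinuous _ hφ₀)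
  refine ⟨(InnerProductSpace.toDual ℝ V).symm φ, ext_inner_right ℝ fun ψ => ?_⟩
  have h1 : ⟪A ((InnerProductSpace.toDual ℝ V).symm φ), ψ⟫_ℝ = φ (A.adjoint ψ) := by
    rw [← ContinuousLinearMap.adjoint_inner_right, InnerProductSpace.toDual_symm_apply]
  have h2 : φ (A.adjoint ψ) = ⟪p, J.adjoint (s ⟨A.adjoint ψ, ψ, rfl⟩)⟫_ℝ :=
    hφ ⟨A.adjoint ψ, ψ, rfl⟩
  have h3 : J.adjoint (s ⟨A.adjoint ψ, ψ, rfl⟩) = J.adjoint ψ := by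
    have := h (s ⟨A.adjoint ψ, ψ, rfl⟩ - ψ)
    rw [map_sub, map_sub, hs', sub_self, norm_zero] at this
    have h0 : ‖J.adjoint (s ⟨A.adjoint ψ, ψ, rfl⟩) - J.adjoint ψ‖ = 0 :=
      le_antisymm (by nlinarith) (norm_nonneg _)
    exact sub_eq_zero.1 (norm_eq_zero.1 h0)
  rw [h1, h2, h3, ContinuousLinearMap.adjoint_inner_right]

variable {E : Type*} [NormedAddCommGroup E] [InnerProductSpace ℝ E] [CompleteSpace E]

theorem norm_sq_eq_integral {α : Type*} [MeasurableSpace α] {ν : Measure α} (f : Lp E 2 ν) :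
    ‖f‖ ^ 2 = ∫ x, ‖f x‖ ^ 2 ∂ν := by
  rw [← real_inner_self_eq_norm_sq, L2.inner_def]
  simp only [real_inner_self_eq_norm_sq]

theorem integrable_coeFn {L : ℝ} (f : Lp E 2 (vol L)) : Integrable f (vol L) :=
  integrable_vol_of_memLp (Lp.memLp f)

variable (E) in
/-- Integration from `0`, as an operator on `L²((0, L); E)`. -/
def primL (L : ℝ) : Lp E 2 (vol L) →L[ℝ] Lp E 2 (vol L) :=
  LinearMap.mkContinuous
    { toFun := fun f =>
        (memLp_vol_of_continuous (L := L) (continuous_prim (integrable_coeFn f))).toLp _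
      map_add' := fun f g => by
        rw [← MemLp.toLp_add]
        refine MemLp.toLp_congr _ _ (Filter.Eventually.of_forall fun t => ?_)
        rw [prim_congr (Lp.coeFn_add f g)]
        exact prim_add (integrable_coeFn f) (integrable_coeFn g) t
      map_smul' := fun c f => by
        rw [RingHom.id_apply, ← MemLp.toLp_const_smul]
        refine MemLp.toLp_congr _ _ (Filter.Eventually.of_forall fun t => ?_)
        rw [prim_congr (Lp.coeFn_smul c f)]
        exact prim_smul c f t }
    ((measureUnivNNReal (vol L) : ℝ) ^ (2 : ℝ≥0∞).toReal⁻¹ * Real.sqrt L) (fun f => by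
      rw [mul_assoc]
      refine Lp.norm_le_of_ae_bound (by positivity) ?_
      filter_upwards [MemLp.coeFn_toLp
        (memLp_vol_of_continuous (L := L) (continuous_prim (integrable_coeFn f))),
        ae_restrict_mem measurableSet_Ioo] with t ht htL
      refine (congrArg norm ht).trans_le ?_
      have := norm_prim_le (htL.1.trans htL.2) (Lp.memLp f) (Ioo_subset_Icc_self htL)
      rwa [← norm_sq_eq_integral, Real.sqrt_sq (norm_nonneg _)] at this)

theorem coeFn_primL {L : ℝ} (f : Lp E 2 (vol L)) : primL E L f =ᵐ[vol L] prim L f :=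
  (memLp_vol_of_continuous (L := L) (continuous_prim (integrable_coeFn f))).coeFn_toLp

theorem prim_memLp {L : ℝ} {f : ℝ → E} (hf : MemLp f 2 (vol L)) : MemLp (prim L f) 2 (vol L) :=
  memLp_vol_of_continuous (continuous_prim (integrable_vol_of_memLp hf))

theorem primL_toLp {L : ℝ} {f : ℝ → E} (hf : MemLp f 2 (vol L)) :
    primL E L hf.toLp = (prim_memLp hf).toLp := by
  refine Lp.ext ((coeFn_primL _).trans ?_)
  rw [prim_congr hf.coeFn_toLp]
  exact (prim_memLp hf).coeFn_toLp.symm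

theorem integral_inner_prim_add {L : ℝ} (hL : 0 ≤ L) {f g : ℝ → E} (hf : Integrable f (vol L))
    (hg : Integrable g (vol L)) :
    ∫ s, ⟪prim L f s, g s⟫_ℝ ∂(vol L) + ∫ s, ⟪f s, prim L g s⟫_ℝ ∂(vol L)
      = ⟪prim L f L, prim L g L⟫_ℝ := by
  have h := bilin_prim_prim (innerSL ℝ) hf hg hL
  change ⟪prim L f L, prim L g L⟫_ℝ = prim L (fun s => ⟪f s, prim L g s⟫_ℝ) L
    + prim L (fun s => ⟪prim L f s, g s⟫_ℝ) L at h
  rw [h, prim_right hL, prim_right hL, add_comm]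

theorem inner_primL_add {L : ℝ} (hL : 0 ≤ L) (f g : Lp E 2 (vol L)) :
    ⟪primL E L f, g⟫_ℝ + ⟪f, primL E L g⟫_ℝ = ⟪prim L f L, prim L g L⟫_ℝ := by
  rw [← integral_inner_prim_add hL (integrable_coeFn f) (integrable_coeFn g), L2.inner_def,
    L2.inner_def]
  congr 1
  · exact integral_congr_ae ((coeFn_primL f).mono fun s hs => by simp only [hs])
  · exact integral_congr_ae ((coeFn_primL g).mono fun s hs => by simp only [hs])

/-- A acts on values and the primitive acts on the variable, so the two commute. -/
theorem primL_compLpL {L : ℝ} (A : E →L[ℝ] E) (f : Lp E 2 (vol L)) :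
    primL E L (A.compLpL 2 (vol L) f) = A.compLpL 2 (vol L) (primL E L f) := by
  refine Lp.ext ((coeFn_primL _).trans ?_)
  refine Filter.EventuallyEq.trans ?_ (A.coeFn_compLpL _).symm
  rw [prim_congr (A.coeFn_compLpL f)]
  filter_upwards [coeFn_primL f] with s hs
  rw [hs, map_prim A (integrable_coeFn f)]

theorem inner_compLpL {L : ℝ} (A : E →L[ℝ] E) (f g : Lp E 2 (vol L)) :
    ⟪A.compLpL 2 (vol L) f, g⟫_ℝ = ∫ s, ⟪A (f s), g s⟫_ℝ ∂(vol L) := by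
  rw [L2.inner_def]
  exact integral_congr_ae ((A.coeFn_compLpL f).mono fun s hs => by simp only [hs])

theorem inner_compLpL_comm {L : ℝ} {A : E →L[ℝ] E} (hA : ∀ x y, ⟪A x, y⟫_ℝ = ⟪x, A y⟫_ℝ)
    (f g : Lp E 2 (vol L)) :
    ⟪A.compLpL 2 (vol L) f, g⟫_ℝ = ⟪f, A.compLpL 2 (vol L) g⟫_ℝ := by
  rw [inner_compLpL, real_inner_comm, inner_compLpL]
  exact integral_congr_ae (Filter.Eventually.of_forall fun s =>
    (hA (f s) (g s)).trans (real_inner_comm (A (g s)) (f s)))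

/-- For a symmetric nonnegative operator `A`, integration from `0` is accretive with respect to
the form `⟪A ·, ·⟫`. -/
theorem integral_inner_prim_nonneg {L : ℝ} (hL : 0 ≤ L) {A : E →L[ℝ] E}
    (hA : ∀ x y, ⟪A x, y⟫_ℝ = ⟪x, A y⟫_ℝ) (hA0 : ∀ x, 0 ≤ ⟪A x, x⟫_ℝ) {f : ℝ → E}
    (hf : Integrable f (vol L)) : 0 ≤ ∫ s, ⟪A (prim L f s), f s⟫_ℝ ∂(vol L) := by
  -- The integral equals half of ⟪A F(L), F(L)⟫ for F = ∫f: both terms of the integration by parts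
  -- coincide by symmetry of A.
  have hAf : Integrable (fun s => A (f s)) (vol L) := A.integrable_comp hf
  have h := integral_inner_prim_add hL hf hAf
  have e1 : ∀ s, ⟪prim L f s, A (f s)⟫_ℝ = ⟪A (prim L f s), f s⟫_ℝ := fun s => (hA _ _).symm
  have e2 : ∀ s, ⟪f s, prim L (fun s => A (f s)) s⟫_ℝ = ⟪A (prim L f s), f s⟫_ℝ := fun s => by
    rw [← map_prim A hf, real_inner_comm]
  have h0 := hA0 (prim L f L)
  rw [hA] at h0
  rw [← map_prim A hf] at h
  simp only [e1, e2] at h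
  linarith

theorem inner_compLpL_primL_nonneg {L : ℝ} (hL : 0 ≤ L) {A : E →L[ℝ] E}
    (hA : ∀ x y, ⟪A x, y⟫_ℝ = ⟪x, A y⟫_ℝ) (hA0 : ∀ x, 0 ≤ ⟪A x, x⟫_ℝ) (f : Lp E 2 (vol L)) :
    0 ≤ ⟪A.compLpL 2 (vol L) (primL E L f), f⟫_ℝ := by
  rw [inner_compLpL, integral_congr_ae (g := fun s => ⟪A (prim L f s), f s⟫_ℝ)]
  · exact integral_inner_prim_nonneg hL hA hA0 (integrable_coeFn f)
  · exact (coeFn_primL f).mono fun s hs => by simp only [hs]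

/-- Solvability of the integrated evolution equation `R z + N ∫z + Q ∬z = ∫p` with symmetric
nonnegative `R`, `Q` and a coercive `N`. -/
theorem exists_integrated_solution {L : ℝ} (hL : 0 ≤ L) {R N Q : E →L[ℝ] E}
    (hR : ∀ x y, ⟪R x, y⟫_ℝ = ⟪x, R y⟫_ℝ) (hR0 : ∀ x, 0 ≤ ⟪R x, x⟫_ℝ)
    {c : ℝ} (hc : 0 < c) (hN0 : ∀ x, c * ‖x‖ ^ 2 ≤ ⟪N x, x⟫_ℝ)
    (hQ : ∀ x y, ⟪Q x, y⟫_ℝ = ⟪x, Q y⟫_ℝ) (hQ0 : ∀ x, 0 ≤ ⟪Q x, x⟫_ℝ) (p : Lp E 2 (vol L)) :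
    ∃ z : Lp E 2 (vol L), R.compLpL 2 (vol L) z + N.compLpL 2 (vol L) (primL E L z)
      + Q.compLpL 2 (vol L) (primL E L (primL E L z)) = primL E L p := by
  set R' := R.compLpL 2 (vol L) with hR'
  set N' := N.compLpL 2 (vol L) with hN'
  set Q' := Q.compLpL 2 (vol L) with hQ'
  set J := primL E L with hJ
  let A : Lp E 2 (vol L) →L[ℝ] Lp E 2 (vol L) := R' + N' ∘L J + Q' ∘L J ∘L J
  refine exists_apply_eq_of_adjoint_bound A J hc (fun ψ => ?_) p
  set φ := J.adjoint ψ with hφ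
  -- test the adjoint equation with `φ`
  have key : c * ‖φ‖ ^ 2 ≤ ⟪φ, A.adjoint ψ⟫_ℝ := by
    rw [ContinuousLinearMap.adjoint_inner_right]
    -- One factor J is moved to the right-hand slot, where J*ψ = φ; this leaves a coercive term in N
    -- and an accretive one in Q.
    have e : ⟪A φ, ψ⟫_ℝ = ⟪R' φ, ψ⟫_ℝ + ⟪N' φ, φ⟫_ℝ + ⟪Q' (J φ), φ⟫_ℝ := by
      have e2 : ⟪N' (J φ), ψ⟫_ℝ = ⟪N' φ, φ⟫_ℝ := by
        rw [hN', ← primL_compLpL, ← ContinuousLinearMap.adjoint_inner_right]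
      have e3 : ⟪Q' (J (J φ)), ψ⟫_ℝ = ⟪Q' (J φ), φ⟫_ℝ := by
        rw [hQ', ← primL_compLpL, ← ContinuousLinearMap.adjoint_inner_right]
      change ⟪R' φ + N' (J φ) + Q' (J (J φ)), ψ⟫_ℝ = _
      rw [inner_add_left, inner_add_left, e2, e3]
    -- By symmetry of R and its commutation with J, this is ⟪R Jψ, ψ⟫, nonnegative by accretivity of
    -- integration.
    have h1 : 0 ≤ ⟪R' φ, ψ⟫_ℝ := by
      have := inner_compLpL_primL_nonneg hL hR hR0 ψ
      rwa [hR', inner_compLpL_comm hR, hφ, ContinuousLinearMap.adjoint_inner_left, hJ,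
        primL_compLpL, real_inner_comm]
    have h2 : c * ‖φ‖ ^ 2 ≤ ⟪N' φ, φ⟫_ℝ := by
      rw [hN', inner_compLpL, norm_sq_eq_integral, ← integral_const_mul]
      refine integral_mono_ae ?_ ?_ (Filter.Eventually.of_forall fun s => hN0 _)
      · exact ((memLp_two_iff_integrable_sq_norm (Lp.memLp φ).1).1 (Lp.memLp φ)).const_mul _
      · refine (L2.integrable_inner (N.compLpL 2 (vol L) φ) φ (𝕜 := ℝ)).congr ?_
        exact (N.coeFn_compLpL φ).mono fun s hs => by simp only [hs]
    have h3 : 0 ≤ ⟪Q' (J φ), φ⟫_ℝ := inner_compLpL_primL_nonneg hL hQ hQ0 φ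
    rw [e]; linarith
  have h2 : ⟪φ, A.adjoint ψ⟫_ℝ ≤ ‖φ‖ * ‖A.adjoint ψ‖ := real_inner_le_norm _ _
  rcases (norm_nonneg φ).eq_or_lt with h0 | h0
  · rw [← h0, mul_zero]; exact norm_nonneg _
  · exact le_of_mul_le_mul_left (by nlinarith : ‖φ‖ * (c * ‖φ‖) ≤ ‖φ‖ * ‖A.adjoint ψ‖) h0

end Operators

/-! ### Multiplication operators with bounded coefficients. -/

section Multiplication

variable {L : ℝ}

/-- Multiplication by an essentially bounded function. -/
def mulOp {c : ℝ → ℝ} (hc : MemLp c ∞ (vol L)) : L2 L →L[ℝ] L2 L :=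
  (ContinuousLinearMap.mul ℝ ℝ).holderL (vol L) ∞ 2 2 hc.toLp

theorem coeFn_mulOp {c : ℝ → ℝ} (hc : MemLp c ∞ (vol L)) (f : L2 L) :
    mulOp hc f =ᵐ[vol L] fun x => c x * f x := by
  refine ((ContinuousLinearMap.mul ℝ ℝ).coeFn_holder (r := 2) hc.toLp f).trans ?_
  filter_upwards [hc.coeFn_toLp] with x hx
  simp [hx]

theorem inner_eq_integral (f g : L2 L) : ⟪f, g⟫_ℝ = ∫ x, f x * g x ∂(vol L) := by
  rw [L2.inner_def]
  exact integral_congr_ae (Filter.Eventually.of_forall fun x => by simp [mul_comm])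

theorem inner_mulOp {c : ℝ → ℝ} (hc : MemLp c ∞ (vol L)) (f g : L2 L) :
    ⟪mulOp hc f, g⟫_ℝ = ∫ x, c x * f x * g x ∂(vol L) := by
  rw [inner_eq_integral]
  exact integral_congr_ae ((coeFn_mulOp hc f).mono fun x hx => by simp only [hx])

theorem mulOp_comm {c : ℝ → ℝ} (hc : MemLp c ∞ (vol L)) (f g : L2 L) :
    ⟪mulOp hc f, g⟫_ℝ = ⟪f, mulOp hc g⟫_ℝ := by
  rw [inner_mulOp, real_inner_comm, inner_mulOp]
  exact integral_congr_ae (Filter.Eventually.of_forall fun x => by ring_nf)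

theorem integrable_mulOp {c : ℝ → ℝ} (hc : MemLp c ∞ (vol L)) (f g : L2 L) :
    Integrable (fun x => c x * f x * g x) (vol L) := by
  refine (L2.integrable_inner (mulOp hc f) g (𝕜 := ℝ)).congr ?_
  filter_upwards [coeFn_mulOp hc f] with x hx
  simp only [hx, RCLike.inner_apply, conj_trivial]; ring

theorem integrable_sq (f : L2 L) : Integrable (fun x => f x ^ 2) (vol L) :=
  (Lp.memLp f).integrable_sq

theorem norm_sq_eq_integral_sq (f : L2 L) : ‖f‖ ^ 2 = ∫ x, f x ^ 2 ∂(vol L) := by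
  rw [norm_sq_eq_integral]; simp

theorem le_inner_mulOp {c : ℝ → ℝ} (hc : MemLp c ∞ (vol L)) {c₀ : ℝ}
    (h : ∀ᵐ x ∂(vol L), c₀ ≤ c x) (f : L2 L) : c₀ * ‖f‖ ^ 2 ≤ ⟪mulOp hc f, f⟫_ℝ := by
  rw [inner_mulOp, norm_sq_eq_integral_sq, ← integral_const_mul]
  refine integral_mono_ae ((integrable_sq f).const_mul _) (integrable_mulOp hc f f) ?_
  filter_upwards [h] with x hx
  nlinarith [sq_nonneg (f x)]

theorem norm_mulOp_le {c : ℝ → ℝ} (hc : MemLp c ∞ (vol L)) {C : ℝ}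
    (h : ∀ᵐ x ∂(vol L), |c x| ≤ C) (f : L2 L) : ‖mulOp hc f‖ ≤ C * ‖f‖ := by
  refine Lp.norm_le_mul_norm_of_ae_le_mul ?_
  filter_upwards [coeFn_mulOp hc f, h] with x hx hx'
  rw [hx, norm_mul]
  exact mul_le_mul_of_nonneg_right hx' (norm_nonneg _)

end Multiplication

/-! ### Sobolev spaces on an interval: completeness, products, reciprocals. -/

section Sobolev

variable {L : ℝ}

/-- The weak derivative of order `j`, as a bounded operator on `H^m(0, L)`. -/
def dxL (m : ℕ) (L : ℝ) (j : Fin (m + 1)) : H m L →L[ℝ] L2 L :=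
  (PiLp.proj 2 (fun _ : Fin (m + 1) => L2 L) j).comp (sobolev m L).subtypeL

theorem dxL_apply {m : ℕ} (j : Fin (m + 1)) (v : H m L) : dxL m L j v = dx v j := rfl

theorem integral_smul_eq_inner {ψ : ℝ → ℝ} (hψ : Continuous ψ) (f : L2 L) :
    ∫ s, ψ s • f s ∂(vol L) = ⟪(memLp_vol_of_continuous (L := L) hψ).toLp ψ, f⟫_ℝ := by
  rw [inner_eq_integral]
  refine integral_congr_ae ?_
  filter_upwards [(memLp_vol_of_continuous (L := L) hψ).coeFn_toLp] with s hs
  rw [hs, smul_eq_mul]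

theorem IsTest.continuous_iteratedDeriv {φ : ℝ → ℝ} (hφ : IsTest L φ) (k : ℕ) :
    Continuous (iteratedDeriv k φ) :=
  hφ.1.continuous_iteratedDeriv k (by exact_mod_cast le_top)

/-- Each defining identity equates two inner products with fixed functions, hence is a closed
condition. This makes H^m complete, as the closed graph theorem and the ODE in H⁴ require. -/
theorem isClosed_sobolev (m : ℕ) (L : ℝ) :
    IsClosed (sobolev m L : Set (PiLp 2 fun _ : Fin (m + 1) => L2 L)) := by
  have : (sobolev m L : Set (PiLp 2 fun _ : Fin (m + 1) => L2 L)) =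
      ⋂ (j : Fin (m + 1)) (φ : ℝ → ℝ) (_ : IsTest L φ),
        {v | ∫ s, iteratedDeriv (j : ℕ) φ s • v 0 s ∂(vol L)
          = (-1 : ℝ) ^ (j : ℕ) • ∫ s, φ s • v j s ∂(vol L)} := by
    ext v
    simp only [mem_iInter]
    rfl
  rw [this]
  refine isClosed_iInter fun j => isClosed_iInter fun φ => isClosed_iInter fun hφ => ?_
  simp only [integral_smul_eq_inner (hφ.continuous_iteratedDeriv j),
    integral_smul_eq_inner hφ.continuous]
  have hc : ∀ i : Fin (m + 1), Continuous fun v : PiLp 2 fun _ : Fin (m + 1) => L2 L => v i :=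
    fun i => (PiLp.proj 2 (fun _ : Fin (m + 1) => L2 L) i : _ →L[ℝ] _).continuous
  exact isClosed_eq (continuous_const.inner (hc 0))
    (continuous_const.mul (continuous_const.inner (hc j)))

instance (m : ℕ) (L : ℝ) : CompleteSpace (H m L) :=
  (isClosed_sobolev m L).completeSpace_coe

theorem dx_zero_injective {m : ℕ} {v w : H m L} (h : dx v 0 = dx w 0) : v = w := by
  refine Subtype.ext (PiLp.ext fun j => Lp.ext ?_)
  have h1 : HasWeakDeriv (j : ℕ) L (dx v 0) (dx v j) := v.2 j
  have h2 : HasWeakDeriv (j : ℕ) L (dx v 0) (dx w j) := h ▸ w.2 j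
  exact h1.ae_eq h2 (integrable_coeFn _) (integrable_coeFn _)

theorem IsTest.iteratedDeriv {φ : ℝ → ℝ} (hφ : IsTest L φ) (k : ℕ) :
    IsTest L (iteratedDeriv k φ) := by
  induction k with
  | zero => simpa using hφ
  | succ k ih => rw [iteratedDeriv_succ]; exact ih.deriv

theorem hasWeakDeriv_zero (f : ℝ → ℝ) : HasWeakDeriv 0 L f f := fun φ _ => by simp

theorem HasWeakDeriv.comp_succ {k : ℕ} {f f' f'' : ℝ → ℝ} (h : HasWeakDeriv 1 L f f')
    (h' : HasWeakDeriv k L f' f'') : HasWeakDeriv (k + 1) L f f'' := by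
  intro φ hφ
  have h1 := h _ (hφ.iteratedDeriv k)
  rw [iteratedDeriv_one, ← iteratedDeriv_succ, h' φ hφ] at h1
  rw [h1, smul_smul, ← pow_add, add_comm]

theorem HasWeakDeriv.of_succ {k : ℕ} {f f' f'' : ℝ → ℝ} (h : HasWeakDeriv 1 L f f')
    (h' : HasWeakDeriv (k + 1) L f f'') : HasWeakDeriv k L f' f'' := by
  intro φ hφ
  have h1 := h _ (hφ.iteratedDeriv k)
  rw [iteratedDeriv_one, ← iteratedDeriv_succ, h' φ hφ, pow_succ'] at h1
  simp only [smul_eq_mul, pow_one] at h1 ⊢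
  linarith

/-- Testing entry j with φ' and entry j + 1 with φ both reduce to v tested with φ^(j+1); comparing
signs gives the relation between consecutive entries. -/
theorem H.hasWeakDeriv {m : ℕ} (v : H (m + 1) L) (j : Fin (m + 1)) :
    HasWeakDeriv 1 L (dx v j.castSucc) (dx v j.succ) := by
  intro φ hφ
  have h1 := v.2 j.castSucc _ hφ.deriv
  have h2 := v.2 j.succ φ hφ
  simp only [Fin.val_castSucc, ← iteratedDeriv_succ'] at h1
  simp only [Fin.val_succ] at h2
  rw [h1, pow_succ', smul_eq_mul, smul_eq_mul, mul_assoc, neg_one_mul, ← mul_neg] at h2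
  have h3 := mul_left_cancel₀ (pow_ne_zero (j : ℕ) (by norm_num : (-1 : ℝ) ≠ 0)) h2
  rw [iteratedDeriv_one, pow_one, neg_one_smul]
  exact h3

/-- `f ∈ L²(0, L)` belongs to `H^m(0, L)`, through iterated primitives. -/
def Sob (L : ℝ) : ℕ → L2 L → Prop
  | 0, _ => True
  | m + 1, f => ∃ (a : ℝ) (f' : L2 L), Sob L m f' ∧ f =ᵐ[vol L] fun x => a + prim L f' x

/-- Bridge between tuples of weak derivatives and iterated primitives. The second form allows
induction on the order for products and reciprocals. -/
theorem sob_iff (hL : 0 < L) {m : ℕ} {f : L2 L} : Sob L m f ↔ ∃ v : H m L, dx v 0 = f := by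
  induction m generalizing f with
  | zero =>
    refine ⟨fun _ => ⟨⟨WithLp.toLp 2 fun _ => f, fun j => ?_⟩, rfl⟩, fun _ => trivial⟩
    obtain rfl : j = 0 := Fin.fin_one_eq_zero j
    exact hasWeakDeriv_zero _
  | succ m ih =>
    constructor
    · rintro ⟨a, f', hf', hff'⟩
      obtain ⟨v, hv⟩ := ih.1 hf'
      have h1 : HasWeakDeriv 1 L f f' :=
        (hasWeakDeriv_add_prim hL.le a (integrable_coeFn f')).congr hff'.symm
          Filter.EventuallyEq.rfl
      refine ⟨⟨WithLp.toLp 2 (Fin.cons f fun j => dx v j), fun j => ?_⟩, rfl⟩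
      refine Fin.cases ?_ (fun i => ?_) j
      · exact hasWeakDeriv_zero _
      · refine HasWeakDeriv.comp_succ h1 ?_
        rw [← hv]
        exact v.2 i
    · rintro ⟨v, rfl⟩
      have h1 : HasWeakDeriv 1 L (dx v 0) (dx v 1) := v.hasWeakDeriv 0
      obtain ⟨a, ha⟩ := h1.exists_ae_eq_add_prim hL (integrable_coeFn _) (integrable_coeFn _)
      refine ⟨a, dx v 1, ih.2 ⟨⟨WithLp.toLp 2 fun j => dx v j.succ, fun j => ?_⟩, rfl⟩, ha⟩
      exact HasWeakDeriv.of_succ h1 (v.2 j.succ)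

theorem sob_dx (hL : 0 < L) {m : ℕ} (v : H m L) : Sob L m (dx v 0) := (sob_iff hL).2 ⟨v, rfl⟩

theorem Sob.add (hL : 0 < L) {m : ℕ} {f g : L2 L} (hf : Sob L m f) (hg : Sob L m g) :
    Sob L m (f + g) := by
  obtain ⟨v, rfl⟩ := (sob_iff hL).1 hf
  obtain ⟨w, rfl⟩ := (sob_iff hL).1 hg
  exact (sob_iff hL).2 ⟨v + w, rfl⟩

theorem Sob.smul (hL : 0 < L) {m : ℕ} (c : ℝ) {f : L2 L} (hf : Sob L m f) :
    Sob L m (c • f) := by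
  obtain ⟨v, rfl⟩ := (sob_iff hL).1 hf
  exact (sob_iff hL).2 ⟨c • v, rfl⟩

theorem Sob.neg (hL : 0 < L) {m : ℕ} {f : L2 L} (hf : Sob L m f) : Sob L m (-f) := by
  simpa using hf.smul hL (-1)

theorem sob_of_ae_const (hL : 0 < L) (m : ℕ) {f : L2 L} {a : ℝ} (hf : f =ᵐ[vol L] fun _ => a) :
    Sob L m f := by
  cases m with
  | zero => trivial
  | succ m =>
    refine ⟨a, 0, (sob_iff hL).2 ⟨0, rfl⟩, hf.trans (Filter.Eventually.of_forall fun x => ?_)⟩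
    rw [prim_congr (Lp.coeFn_zero ℝ 2 (vol L))]
    simp [prim]

theorem Sob.of_succ {m : ℕ} {f : L2 L} (hf : Sob L (m + 1) f) : Sob L m f := by
  induction m generalizing f with
  | zero => trivial
  | succ m ih =>
    obtain ⟨a, f', hf', h⟩ := hf
    exact ⟨a, f', ih hf', h⟩

theorem Sob.mono {m k : ℕ} {f : L2 L} (hf : Sob L m f) (hk : k ≤ m) : Sob L k f := by
  induction hk with
  | refl => exact hf
  | step _ ih => exact ih hf.of_succ

theorem Sob.primL {m : ℕ} {f : L2 L} (hf : Sob L m f) : Sob L (m + 1) (primL ℝ L f) :=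
  ⟨0, f, hf, (coeFn_primL f).trans (Filter.Eventually.of_forall fun _ => (zero_add _).symm)⟩

theorem memLp_top_of_ae_eq_continuous {f c : ℝ → ℝ} (hc : Continuous c) (h : f =ᵐ[vol L] c) :
    MemLp f ∞ (vol L) := by
  obtain ⟨C, hC⟩ := (isCompact_Icc (a := (0 : ℝ)) (b := L)).exists_bound_of_continuousOn
    hc.continuousOn
  have : MemLp c ∞ (vol L) := memLp_top_of_bound (integrable_vol_of_continuous hc).1 C
    ((ae_restrict_mem measurableSet_Ioo).mono fun x hx => hC x (Ioo_subset_Icc_self hx))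
  exact this.ae_eq h.symm

theorem Sob.memLp_top {m : ℕ} (hm : 1 ≤ m) {f : L2 L} (hf : Sob L m f) : MemLp f ∞ (vol L) := by
  obtain ⟨a, f', -, h⟩ := hf.mono hm
  exact memLp_top_of_ae_eq_continuous
    (continuous_const.add (continuous_prim (integrable_coeFn f'))) h

/-- Induction through the product rule (fg)' = f'g + fg'. The roles of the factors are exchanged for
the second summand, so that in each summand the undifferentiated factor has the higher order. -/
theorem Sob.mul (hL : 0 < L) {m : ℕ} {f g h : L2 L} (hf : Sob L m f) (hg : Sob L (max m 1) g)
    (hh : h =ᵐ[vol L] fun x => f x * g x) : Sob L m h := by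
  induction m generalizing f g h with
  | zero => trivial
  | succ m ih =>
    have hg' : Sob L (m + 1) g := hg.mono (le_max_left _ _)
    have hf1 := hf.memLp_top (by omega)
    have hg1 := hg'.memLp_top (by omega)
    obtain ⟨a, f', hf', hff'⟩ := id hf
    obtain ⟨b, g', hg'', hgg'⟩ := id hg'
    have hp := ih hf' (hg'.mono (by omega : max m 1 ≤ m + 1)) (h := mulOp hg1 f')
      ((coeFn_mulOp hg1 f').trans (Filter.Eventually.of_forall fun x => mul_comm _ _))
    have hq := ih hg'' (hf.mono (by omega : max m 1 ≤ m + 1)) (h := mulOp hf1 g')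
      ((coeFn_mulOp hf1 g').trans (Filter.Eventually.of_forall fun x => mul_comm _ _))
    refine ⟨a * b, mulOp hg1 f' + mulOp hf1 g', hp.add hL hq, ?_⟩
    have hpq : ⇑(mulOp hg1 f' + mulOp hf1 g') =ᵐ[vol L] fun s =>
        f' s * (b + prim L g' s) + (a + prim L f' s) * g' s := by
      filter_upwards [Lp.coeFn_add (mulOp hg1 f') (mulOp hf1 g'), coeFn_mulOp hg1 f',
        coeFn_mulOp hf1 g', hff', hgg'] with s h1 h2 h3 h4 h5
      rw [h1, Pi.add_apply, h2, h3, h4, h5]; ring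
    rw [prim_congr hpq]
    filter_upwards [hh, hff', hgg', ae_restrict_mem measurableSet_Ioo] with x h1 h2 h3 hx
    rw [h1, h2, h3]
    exact bilin_add_prim (ContinuousLinearMap.mul ℝ ℝ) a b (integrable_coeFn f')
      (integrable_coeFn g') hx.1.le

/-- On values at least c the map y ↦ 1/y is Lipschitz with constant 1/c². -/
theorem absolutelyContinuousOnInterval_inv {k : ℝ → ℝ} {a b c : ℝ} (hc : 0 < c)
    (hk : AbsolutelyContinuousOnInterval k a b) (hkc : ∀ x ∈ uIcc a b, c ≤ k x) :
    AbsolutelyContinuousOnInterval (fun x => (k x)⁻¹) a b := by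
  rw [absolutelyContinuousOnInterval_iff] at hk ⊢
  intro ε hε
  obtain ⟨δ, hδ, h⟩ := hk (c ^ 2 * ε) (by positivity)
  refine ⟨δ, hδ, fun I hI hId => ?_⟩
  have h1 := h I hI hId
  have h2 : ∀ i ∈ Finset.range I.1, dist (k (I.2 i).1)⁻¹ (k (I.2 i).2)⁻¹
      ≤ (c ^ 2)⁻¹ * dist (k (I.2 i).1) (k (I.2 i).2) := by
    intro i hi
    have h3 := hkc _ (hI.1 i hi).1
    have h4 := hkc _ (hI.1 i hi).2
    have h3' := hc.trans_le h3
    have h4' := hc.trans_le h4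
    rw [Real.dist_eq, Real.dist_eq, inv_sub_inv h3'.ne' h4'.ne', abs_div, abs_sub_comm,
      div_eq_inv_mul]
    refine mul_le_mul_of_nonneg_right ?_ (abs_nonneg _)
    rw [abs_of_pos (mul_pos h3' h4')]
    exact inv_anti₀ (by positivity) (by nlinarith)
  calc _ ≤ ∑ i ∈ Finset.range I.1, (c ^ 2)⁻¹ * dist (k (I.2 i).1) (k (I.2 i).2) :=
        Finset.sum_le_sum h2
    _ = (c ^ 2)⁻¹ * ∑ i ∈ Finset.range I.1, dist (k (I.2 i).1) (k (I.2 i).2) := by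
        rw [Finset.mul_sum]
    _ < (c ^ 2)⁻¹ * (c ^ 2 * ε) := mul_lt_mul_of_pos_left h1 (by positivity)
    _ = ε := by field_simp

/-- A reciprocal of an absolutely continuous function bounded below is absolutely continuous, so the
fundamental theorem of calculus applies to it; its derivative exists almost everywhere by Lebesgue
differentiation of the primitive. -/
theorem inv_add_prim {a c : ℝ} (hc : 0 < c) {f : ℝ → ℝ} (hf : Integrable f (vol L))
    (hk : ∀ x ∈ Icc 0 L, c ≤ a + prim L f x) {x : ℝ} (hx : x ∈ Icc 0 L) :
    (a + prim L f x)⁻¹ = a⁻¹ + prim L (fun s => -f s / (a + prim L f s) ^ 2) x := by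
  have hi : IntervalIntegrable ((Ioo 0 L).indicator f) volume 0 x :=
    (integrable_indicator_Ioo hf).intervalIntegrable
  have hsub : uIcc 0 x ⊆ Icc 0 L := by
    rw [uIcc_of_le hx.1]; exact Icc_subset_Icc le_rfl hx.2
  have hac : AbsolutelyContinuousOnInterval (fun x => a + prim L f x) 0 x := by
    have h1 : AbsolutelyContinuousOnInterval (fun _ : ℝ => a) 0 x :=
      (LipschitzWith.const a).lipschitzOnWith.absolutelyContinuousOnInterval
    exact h1.add (hi.absolutelyContinuousOnInterval_intervalIntegral left_mem_uIcc)
  have h := (absolutelyContinuousOnInterval_inv hc hac fun y hy =>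
    hk y (hsub hy)).integral_deriv_eq_sub
  rw [prim_at_zero, add_zero] at h
  rw [← sub_eq_iff_eq_add', ← h]
  refine intervalIntegral.integral_congr_ae ?_
  filter_upwards [hi.ae_hasDerivAt_integral] with s hs hs'
  have hs'' := uIoc_subset_uIcc hs'
  have hd : HasDerivAt (fun x => a + prim L f x) ((Ioo 0 L).indicator f s) s :=
    (hs hs'' 0 left_mem_uIcc).const_add a
  have hne : a + prim L f s ≠ 0 := (hc.trans_le (hk s (hsub hs''))).ne'
  rw [(hd.fun_inv hne).deriv]
  by_cases hsL : s ∈ Ioo 0 L <;> simp [hsL]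

/-- Induction on the order: (1/f)' = -f'/f² is the product h · h · (-f'), in which h has order m by
induction and f' by assumption. -/
theorem Sob.inv (hL : 0 < L) {m : ℕ} {f h : L2 L} {c : ℝ} (hc : 0 < c)
    (hf : Sob L m f) (hfc : ∀ᵐ x ∂(vol L), c ≤ f x) (hh : h =ᵐ[vol L] fun x => (f x)⁻¹) :
    Sob L m h := by
  induction m with
  | zero => trivial
  | succ m ih =>
    have hSh : Sob L m h := ih hf.of_succ
    obtain ⟨a, f', hf', hff'⟩ := id hf
    have hcont : Continuous fun x => a + prim L f' x :=
      continuous_const.add (continuous_prim (integrable_coeFn f'))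
    -- The lower bound passes from almost every point to every point because max(c, ·) of the
    -- continuous representative and the representative itself are continuous and agree almost
    -- everywhere.
    have hlow : ∀ x ∈ Icc 0 L, c ≤ a + prim L f' x := by
      have h1 : (fun x => max c (a + prim L f' x)) =ᵐ[volume.restrict (Icc 0 L)]
          fun x => a + prim L f' x := by
        rw [← restrict_Ioc_eq_restrict_Icc, ← restrict_Ioo_eq_restrict_Ioc]
        filter_upwards [hff', hfc] with x h2 h3
        rw [← h2, max_eq_right h3]
      intro x hx
      have := Measure.eqOn_Icc_of_ae_eq volume hL.ne h1
        (continuous_const.max hcont).continuousOn hcont.continuousOn hx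
      exact (le_max_left _ _).trans_eq this
    have hinv := fun x (hx : x ∈ Icc 0 L) =>
      inv_add_prim hc (integrable_coeFn f') hlow hx
    have hhtop : MemLp h ∞ (vol L) := by
      refine memLp_top_of_bound (Lp.memLp h).1 c⁻¹ ?_
      filter_upwards [hh, hfc] with x h1 h2
      rw [h1, Real.norm_eq_abs, abs_inv, abs_of_pos (hc.trans_le h2)]
      exact inv_anti₀ hc h2
    have hq : Sob L m (mulOp hhtop (mulOp hhtop (-f'))) := by
      rcases Nat.eq_zero_or_pos m with rfl | hm
      · trivial
      · have hSh' : Sob L (max m 1) h := by rwa [max_eq_left hm]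
        have h1 : ∀ g, Sob L m g → Sob L m (mulOp hhtop g) := fun g hg => hg.mul hL hSh'
          ((coeFn_mulOp hhtop g).trans (Filter.Eventually.of_forall fun x => mul_comm _ _))
        exact h1 _ (h1 _ (hf'.neg hL))
    refine ⟨a⁻¹, _, hq, ?_⟩
    have hqe : ⇑(mulOp hhtop (mulOp hhtop (-f'))) =ᵐ[vol L]
        fun s => -f' s / (a + prim L f' s) ^ 2 := by
      filter_upwards [coeFn_mulOp hhtop (mulOp hhtop (-f')), coeFn_mulOp hhtop (-f'),
        Lp.coeFn_neg f', hh, hff'] with s h1 h2 h3 h4 h5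
      rw [h1, h2, h3, h4, h5, Pi.neg_apply]
      field_simp
    rw [prim_congr hqe]
    filter_upwards [hh, hff', ae_restrict_mem measurableSet_Ioo] with x h1 h2 hx
    rw [h1, h2, hinv x (Ioo_subset_Icc_self hx)]

/-- A bounded operator into `L²(0, L)` with values in `H^m(0, L)` is bounded into `H^m(0, L)`. -/
theorem exists_lift (hL : 0 < L) {X : Type*} [NormedAddCommGroup X] [NormedSpace ℝ X]
    [CompleteSpace X] (m : ℕ) (N : X →L[ℝ] L2 L) (h : ∀ x, Sob L m (N x)) :
    ∃ N' : X →L[ℝ] H m L, ∀ x, dx (N' x) 0 = N x := by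
  choose n hn using fun x => (sob_iff hL).1 (h x)
  let n' : X →ₗ[ℝ] H m L :=
    { toFun := n
      map_add' := fun x y => dx_zero_injective (by
        change dx (n (x + y)) 0 = dx (n x) 0 + dx (n y) 0
        rw [hn, hn, hn, map_add])
      map_smul' := fun c x => dx_zero_injective (by
        change dx (n (c • x)) 0 = c • dx (n x) 0
        rw [hn, hn, map_smul]) }
  -- The graph is closed because H^m embeds continuously and injectively in L², where the operator
  -- is already known to be continuous.
  refine ⟨ContinuousLinearMap.ofSeqClosedGraph (g := n') fun u x y hu hy => ?_, hn⟩
  refine dx_zero_injective (tendsto_nhds_unique (((dxL m L 0).continuous.tendsto y).comp hy) ?_)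
  have : (dxL m L 0) ∘ n' ∘ u = N ∘ u := funext fun i => hn (u i)
  rw [this]
  change Filter.Tendsto _ _ (nhds (dx (n x) 0))
  rw [hn]
  exact (N.continuous.tendsto x).comp hu

end Sobolev

/-! ### The clamped space V_1² as the range of the twofold primitive. -/

section Clamped

variable {L : ℝ}

/-- The constant function `1` in `L²(0, L)`. -/
def oneL (L : ℝ) : L2 L := (memLp_vol_of_continuous (L := L) (continuous_const (y := (1 : ℝ)))).toLp

theorem coeFn_oneL : oneL L =ᵐ[vol L] fun _ => (1 : ℝ) :=
  (memLp_vol_of_continuous (L := L) (continuous_const (y := (1 : ℝ)))).coeFn_toLp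

theorem inner_oneL (f : L2 L) : ⟪oneL L, f⟫_ℝ = ∫ x, f x ∂(vol L) := by
  rw [inner_eq_integral]
  exact integral_congr_ae (coeFn_oneL.mono fun x hx => by simp only [hx, one_mul])

/-- The adjoint is integration from the right end, ∫_x^L h. Written as a constant minus a primitive,
it visibly gains one derivative as well. -/
theorem adjoint_primL (hL : 0 ≤ L) (h : L2 L) :
    (primL ℝ L).adjoint h = (∫ x, h x ∂(vol L)) • oneL L - primL ℝ L h := by
  refine ext_inner_right ℝ fun f => ?_
  have h1 := inner_primL_add hL h f
  rw [ContinuousLinearMap.adjoint_inner_left, inner_sub_left, real_inner_smul_left, inner_oneL]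
  rw [prim_right hL, prim_right hL, RCLike.inner_apply, conj_trivial] at h1
  linarith

theorem Sob.adjoint_primL (hL : 0 < L) {m : ℕ} {f : L2 L} (hf : Sob L m f) :
    Sob L (m + 1) ((Beam.primL ℝ L).adjoint f) := by
  rw [Beam.adjoint_primL hL.le, sub_eq_add_neg]
  exact ((sob_of_ae_const hL _ coeFn_oneL).smul hL _).add hL (hf.primL.neg hL)

/-- The twofold primitive, that is, the inverse of `v ↦ v_xx` on `V_1²(0, L)`. -/
def dprim (L : ℝ) : L2 L →L[ℝ] L2 L := (primL ℝ L).comp (primL ℝ L)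

theorem dprim_apply (f : L2 L) : dprim L f = primL ℝ L (primL ℝ L f) := rfl

theorem adjoint_dprim (f : L2 L) :
    (dprim L).adjoint f = (primL ℝ L).adjoint ((primL ℝ L).adjoint f) := by
  rw [dprim, ContinuousLinearMap.adjoint_comp]; rfl

theorem Sob.dprim {m : ℕ} {f : L2 L} (hf : Sob L m f) : Sob L (m + 2) (dprim L f) :=
  hf.primL.primL

theorem Sob.adjoint_dprim (hL : 0 < L) {m : ℕ} {f : L2 L} (hf : Sob L m f) :
    Sob L (m + 2) ((Beam.dprim L).adjoint f) := by
  rw [Beam.adjoint_dprim]; exact (hf.adjoint_primL hL).adjoint_primL hL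

/-- The Riesz representative of `f ↦ (∫∫f)(L)`. -/
def tipL (L : ℝ) : L2 L := (primL ℝ L).adjoint (oneL L)

theorem sob_tipL (hL : 0 < L) (m : ℕ) : Sob L m (tipL L) :=
  ((sob_of_ae_const hL m coeFn_oneL).adjoint_primL hL).of_succ

theorem coeFn_tipL (hL : 0 ≤ L) : tipL L =ᵐ[vol L] fun x => L - x := by
  have h1 : ∫ x, oneL L x ∂(vol L) = L := by
    rw [integral_congr_ae coeFn_oneL]; simp [hL]
  rw [tipL, adjoint_primL hL, h1]
  filter_upwards [Lp.coeFn_sub (L • oneL L) (primL ℝ L (oneL L)), Lp.coeFn_smul L (oneL L),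
    coeFn_oneL (L := L), coeFn_primL (oneL L), ae_restrict_mem measurableSet_Ioo]
    with x h1 h2 h3 h4 hx
  rw [h1, Pi.sub_apply, h2, h4, Pi.smul_apply, h3, prim_congr coeFn_oneL,
    prim_eq_setIntegral (Ioo_subset_Icc_self hx)]
  simp [hx.1.le]

theorem norm_tipL_sq (hL : 0 ≤ L) : ‖tipL L‖ ^ 2 = L ^ 3 / 3 := by
  rw [norm_sq_eq_integral_sq, integral_congr_ae (g := fun x => (L - x) ^ 2)
    ((coeFn_tipL hL).mono fun x hx => by simp only [hx]),
    vol, restrict_Ioo_eq_restrict_Ioc, ← intervalIntegral.integral_of_le hL,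
    intervalIntegral.integral_comp_sub_left (fun x => x ^ 2) L]
  simp [integral_pow]
  norm_num

theorem primL_injective (hL : 0 < L) {f : L2 L} (h : primL ℝ L f = 0) : f = 0 := by
  have h1 : HasWeakDeriv 1 L (0 : L2 L) f :=
    (hasWeakDeriv_prim hL.le (integrable_coeFn f)).congr
      ((coeFn_primL f).symm.trans (by rw [h])) Filter.EventuallyEq.rfl
  have h2 : HasWeakDeriv 1 L (0 : L2 L) (0 : L2 L) := (0 : H 1 L).2 1
  exact Lp.ext (h1.ae_eq h2 (integrable_coeFn _) (integrable_coeFn _))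

theorem dprim_injective (hL : 0 < L) {f : L2 L} (h : dprim L f = 0) : f = 0 :=
  primL_injective hL (primL_injective hL h)

theorem dx_zero_eq_dprim (hL : 0 < L) {v : H 2 L} (hv : v ∈ V12 L) :
    dx v 0 = dprim L (dx v 2) := by
  have h0 := (v.hasWeakDeriv 0).ae_eq_prim hL (integrable_coeFn _) (integrable_coeFn _) hv.1
  have h1 := (v.hasWeakDeriv 1).ae_eq_prim hL (integrable_coeFn _) (integrable_coeFn _) hv.2
  have e1 : dx v 1 = primL ℝ L (dx v 2) := Lp.ext (h1.trans (coeFn_primL _).symm)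
  have e0 : dx v 0 = primL ℝ L (dx v 1) := Lp.ext (h0.trans (coeFn_primL _).symm)
  rw [e0, e1]; rfl

theorem dx_of_dx_zero_eq_dprim (hL : 0 < L) {v : H 2 L} {f : L2 L} (h : dx v 0 = dprim L f) :
    dx v 2 = f ∧ v ∈ V12 L := by
  have key : ∀ {p q : L2 L} {p' : L2 L}, HasWeakDeriv 1 L p p' → p = primL ℝ L q → p' = q := by
    intro p q p' h1 h2
    refine Lp.ext (h1.ae_eq ?_ (integrable_coeFn _) (integrable_coeFn _))
    refine (hasWeakDeriv_prim hL.le (integrable_coeFn q)).congr ?_ Filter.EventuallyEq.rfl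
    rw [h2]; exact (coeFn_primL q).symm
  have e1 : dx v 1 = primL ℝ L f := key (v.hasWeakDeriv 0) h
  have e2 : dx v 2 = f := key (v.hasWeakDeriv 1) e1
  refine ⟨e2, ?_, ?_⟩
  · rw [h, dprim_apply]
    have := HasValueAt.of_continuous (continuous_prim (integrable_coeFn (primL ℝ L f)))
      (coeFn_primL (primL ℝ L f)) 0
    rwa [prim_at_zero] at this
  · rw [e1]
    have := HasValueAt.of_continuous (continuous_prim (integrable_coeFn f)) (coeFn_primL f) 0
    rwa [prim_at_zero] at this

/-- The inverse of v ↦ v_xx as a bounded operator into H². It supplies all test functions and turns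
solutions f = u_xx into functions with values in V_1². -/
theorem exists_clamped (hL : 0 < L) : ∃ N : L2 L →L[ℝ] H 2 L,
    ∀ f, dx (N f) 0 = dprim L f ∧ dx (N f) 2 = f ∧ N f ∈ V12 L := by
  obtain ⟨N, hN⟩ := exists_lift hL 2 (dprim L) fun f => Sob.dprim (m := 0) trivial
  exact ⟨N, fun f => ⟨hN f, dx_of_dx_zero_eq_dprim hL (hN f)⟩⟩

theorem prim_primL_right (hL : 0 ≤ L) (f : L2 L) : prim L (primL ℝ L f) L = ⟪tipL L, f⟫_ℝ := by
  rw [prim_right hL, tipL, ContinuousLinearMap.adjoint_inner_left, inner_oneL]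

/-- Turns the boundary load at x = L into an inner product with v_xx, which is how g enters the
equation in L². -/
theorem hasValueAt_tip_iff (hL : 0 < L) {v : H 2 L} (hv : v ∈ V12 L) {a : ℝ} :
    HasValueAt L (dx v 0) L a ↔ a = ⟪tipL L, dx v 2⟫_ℝ := by
  rw [dx_zero_eq_dprim hL hv, dprim_apply, ← prim_primL_right hL.le]
  have hc := continuous_prim (integrable_coeFn (primL ℝ L (dx v 2)))
  constructor
  · intro h
    exact (h.eq_of_ae_eq hL hc.continuousOn (coeFn_primL _) ⟨hL.le, le_rfl⟩).symm
  · rintro rfl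
    exact HasValueAt.of_continuous hc (coeFn_primL _) L

/-- The variational equation on `V_1²(0, L)`, in terms of the second derivatives. -/
theorem variational_iff (hL : 0 < L) {ρ μ r κ : ℝ → ℝ} (hρ : MemLp ρ ∞ (vol L))
    (hμ : MemLp μ ∞ (vol L)) (hr : MemLp r ∞ (vol L)) (hκ : MemLp κ ∞ (vol L))
    {w w' : H 2 L} (hw' : w' ∈ V12 L) (p : L2 L) (γ : ℝ) :
    (∀ v ∈ V12 L, ∀ vL : ℝ, HasValueAt L (dx v 0) L vL →
      ∫ x, ρ x * p x * dx v 0 x ∂(vol L) + ∫ x, μ x * dx w' 0 x * dx v 0 x ∂(vol L)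
        + ∫ x, r x * dx w 2 x * dx v 2 x ∂(vol L)
        + ∫ x, κ x * dx w' 2 x * dx v 2 x ∂(vol L) = γ * vL) ↔
    (dprim L).adjoint (mulOp hρ p + mulOp hμ (dprim L (dx w' 2))) + mulOp hr (dx w 2)
      + mulOp hκ (dx w' 2) = γ • tipL L := by
  simp only [← inner_mulOp hρ, ← inner_mulOp hμ, ← inner_mulOp hr, ← inner_mulOp hκ]
  rw [dx_zero_eq_dprim hL hw']
  constructor
  · intro h
    obtain ⟨N, hN⟩ := exists_clamped hL
    refine ext_inner_right ℝ fun f => ?_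
    have h1 := h (N f) (hN f).2.2 _ ((hasValueAt_tip_iff hL (hN f).2.2).2 rfl)
    rw [(hN f).1, (hN f).2.1] at h1
    rw [inner_add_left, inner_add_left, ContinuousLinearMap.adjoint_inner_left, inner_add_left,
      real_inner_smul_left]
    exact h1
  · intro h v hv vL hvL
    rw [hasValueAt_tip_iff hL hv] at hvL
    rw [hvL, dx_zero_eq_dprim hL hv, ← real_inner_smul_left, ← h, inner_add_left, inner_add_left,
      ContinuousLinearMap.adjoint_inner_left, inner_add_left]

end Clamped

/-! ### The abstract evolution equation: existence, uniqueness, energy estimate. -/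

section Evolution

theorem prim_mono {L : ℝ} {f g : ℝ → ℝ} (hf : Integrable f (vol L)) (hg : Integrable g (vol L))
    (h : ∀ᵐ s ∂(vol L), f s ≤ g s) {t : ℝ} (ht : 0 ≤ t) : prim L f t ≤ prim L g t := by
  refine intervalIntegral.integral_mono_ae ht (integrable_indicator_Ioo hf).intervalIntegrable
    (integrable_indicator_Ioo hg).intervalIntegrable ?_
  filter_upwards [(ae_restrict_iff' measurableSet_Ioo).1 h] with s hs
  by_cases hs' : s ∈ Ioo 0 L
  · simpa [hs'] using hs hs'
  · simp [hs']

theorem prim_nonneg {L : ℝ} {f : ℝ → ℝ} (h : ∀ s, 0 ≤ f s) {t : ℝ} (ht : 0 ≤ t) :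
    0 ≤ prim L f t :=
  intervalIntegral.integral_nonneg_of_forall ht fun s => indicator_nonneg (fun x _ => h x) s

theorem prim_le_prim_right {L : ℝ} {f : ℝ → ℝ} (hf : Integrable f (vol L)) (h : ∀ s, 0 ≤ f s)
    {t : ℝ} (ht : t ∈ Icc 0 L) : prim L f t ≤ prim L f L := by
  rw [prim_eq_setIntegral ht, prim_eq_setIntegral ⟨ht.1.trans ht.2, le_rfl⟩]
  exact setIntegral_mono_set hf (Filter.Eventually.of_forall h)
    (Ioo_subset_Ioo le_rfl ht.2).eventuallyLE

/-- Only the right derivative is available at 0, since the integrand is extended by zero; this is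
the form that Gronwall's inequality and ODE uniqueness use. -/
theorem hasDerivWithinAt_prim {E : Type*} [NormedAddCommGroup E] [NormedSpace ℝ E]
    [CompleteSpace E] {L : ℝ} {f : ℝ → E} (hf : Continuous f) {t : ℝ} (ht : t ∈ Ico 0 L) :
    HasDerivWithinAt (prim L f) (f t) (Ici t) t := by
  have h1 : HasDerivAt (fun t => ∫ s in (0 : ℝ)..t, f s) (f t) t :=
    intervalIntegral.integral_hasDerivAt_right (hf.intervalIntegrable _ _)
      (hf.stronglyMeasurableAtFilter _ _) hf.continuousAt
  have h2 : ∀ s ∈ Icc 0 L, prim L f s = ∫ s in (0 : ℝ)..s, f s := fun s hs => by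
    rw [prim_eq_setIntegral hs, restrict_Ioo_eq_restrict_Ioc,
      ← intervalIntegral.integral_of_le hs.1]
  refine h1.hasDerivWithinAt.congr_of_eventuallyEq ?_ (h2 t ⟨ht.1, ht.2.le⟩)
  filter_upwards [Icc_mem_nhdsGE ht.2] with s hs
  exact h2 s ⟨ht.1.trans hs.1, hs.2⟩

variable {X : Type*} [NormedAddCommGroup X] [InnerProductSpace ℝ X]

theorem integrable_norm_sq {L : ℝ} {f : ℝ → X} (hf : MemLp f 2 (vol L)) :
    Integrable (fun s => ‖f s‖ ^ 2) (vol L) :=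
  (memLp_two_iff_integrable_sq_norm hf.1).1 hf

theorem integrable_inner {L : ℝ} {f g : ℝ → X} (hf : MemLp f 2 (vol L)) (hg : MemLp g 2 (vol L)) :
    Integrable (fun s => ⟪f s, g s⟫_ℝ) (vol L) :=
  memLp_one_iff_integrable.1 ((innerSL ℝ).memLp_of_bilin 1 hf hg)

variable [CompleteSpace X]

theorem inner_clm_prim {L : ℝ} (A : X →L[ℝ] X) {f g : ℝ → X} (hf : Integrable f (vol L))
    (hg : Integrable g (vol L)) {t : ℝ} (ht : 0 ≤ t) :
    ⟪A (prim L f t), prim L g t⟫_ℝ = prim L (fun s => ⟪A (f s), prim L g s⟫_ℝ) t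
      + prim L (fun s => ⟪A (prim L f s), g s⟫_ℝ) t := by
  have h := bilin_prim_prim (innerSL ℝ) (A.integrable_comp hf) hg ht
  simp only [← map_prim A hf] at h
  exact h

/-- Nonnegativity of the solution's energy forces the homogeneous problem to be trivial. -/
theorem ae_eq_zero_of_homogeneous {T : ℝ} (hT : 0 < T) {S P M Q C : X →L[ℝ] X}
    (hP : ∀ x y, ⟪P x, y⟫_ℝ = ⟪x, P y⟫_ℝ) (hP0 : ∀ x, 0 ≤ ⟪P x, x⟫_ℝ)
    (hM0 : ∀ x, 0 ≤ ⟪M x, x⟫_ℝ)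
    (hQ : ∀ x y, ⟪Q x, y⟫_ℝ = ⟪x, Q y⟫_ℝ) (hQ0 : ∀ x, 0 ≤ ⟪Q x, x⟫_ℝ)
    {c : ℝ} (hc : 0 < c) (hC : ∀ x, c * ‖x‖ ^ 2 ≤ ⟪C x, x⟫_ℝ)
    {d q : ℝ → X} (hd : MemLp d 2 (vol T)) (hq : MemLp q 2 (vol T))
    (hdq : ∀ᵐ t ∂(vol T), S (d t) = prim T q t)
    (heq : ∀ᵐ t ∂(vol T), S.adjoint (P (q t) + M (S (d t))) + Q (prim T d t) + C (d t) = 0) :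
    d =ᵐ[vol T] 0 := by
  have id := integrable_vol_of_memLp hd
  have iq := integrable_vol_of_memLp hq
  have h1 := integral_inner_prim_nonneg hT.le hP hP0 iq
  have h2 := integral_inner_prim_nonneg hT.le hQ hQ0 id
  have i1 : Integrable (fun s => ⟪P (prim T q s), q s⟫_ℝ) (vol T) :=
    integrable_inner (P.comp_memLp' (prim_memLp hq)) hq
  have i2 : Integrable (fun s => ⟪Q (prim T d s), d s⟫_ℝ) (vol T) :=
    integrable_inner (Q.comp_memLp' (prim_memLp hd)) hd
  have i3 : Integrable (fun s => c * ‖d s‖ ^ 2) (vol T) := (integrable_norm_sq hd).const_mul c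
  -- The equation is tested with d. Since S d = ∫q, the P-term becomes ⟪P∫q, q⟫, whose time integral
  -- is nonnegative, like that of the Q-term; only d = 0 is compatible with the coercive C-term.
  have hsum : ∫ s, (⟪P (prim T q s), q s⟫_ℝ + ⟪Q (prim T d s), d s⟫_ℝ + c * ‖d s‖ ^ 2) ∂(vol T)
      ≤ 0 := by
    refine integral_nonpos_of_ae ?_
    filter_upwards [hdq, heq] with t ht1 ht2
    have h3 := congrArg (fun x => ⟪x, d t⟫_ℝ) ht2
    simp only [inner_add_left, inner_zero_left, ContinuousLinearMap.adjoint_inner_left] at h3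
    have h4 := hM0 (S (d t))
    have h5 := hC (d t)
    have h6 : ⟪P (q t), S (d t)⟫_ℝ = ⟪P (prim T q t), q t⟫_ℝ := by
      rw [ht1, hP, real_inner_comm]
    simp only [Pi.zero_apply]
    linarith
  have i12 : Integrable (fun s => ⟪P (prim T q s), q s⟫_ℝ + ⟪Q (prim T d s), d s⟫_ℝ) (vol T) :=
    i1.add i2
  rw [integral_add i12 i3, integral_add i1 i2] at hsum
  have h7 : ∫ s, c * ‖d s‖ ^ 2 ∂(vol T) = 0 :=
    le_antisymm (by linarith) (integral_nonneg fun s => by positivity)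
  have h8 := (integral_eq_zero_iff_of_nonneg (fun s => by positivity) i3).1 h7
  filter_upwards [h8] with s hs
  simp only [Pi.zero_apply, mul_eq_zero, hc.ne', false_or, pow_eq_zero_iff two_ne_zero,
    norm_eq_zero] at hs
  exact hs

/-- Here R = S*PS and N = S*MS + C. The coercivity of N comes from C alone, and S is not required to
be injective. -/
theorem exists_evolution_solution {T : ℝ} (hT : 0 < T) {S P M Q C : X →L[ℝ] X}
    (hP : ∀ x y, ⟪P x, y⟫_ℝ = ⟪x, P y⟫_ℝ) (hP0 : ∀ x, 0 ≤ ⟪P x, x⟫_ℝ)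
    (hM0 : ∀ x, 0 ≤ ⟪M x, x⟫_ℝ)
    (hQ : ∀ x y, ⟪Q x, y⟫_ℝ = ⟪x, Q y⟫_ℝ) (hQ0 : ∀ x, 0 ≤ ⟪Q x, x⟫_ℝ)
    {c : ℝ} (hc : 0 < c) (hC : ∀ x, c * ‖x‖ ^ 2 ≤ ⟪C x, x⟫_ℝ)
    (e : X) {γ : ℝ → ℝ} (hγ : MemLp γ 2 (vol T)) :
    ∃ z : ℝ → X, MemLp z 2 (vol T) ∧ ∀ᵐ t ∂(vol T),
      S.adjoint (P (S (z t)) + M (S (prim T z t))) + Q (prim T (prim T z) t) + C (prim T z t)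
        = prim T γ t • e := by
  have hp : MemLp (fun t => γ t • e) 2 (vol T) :=
    (ContinuousLinearMap.toSpanSingleton ℝ e).comp_memLp' hγ
  obtain ⟨R, hRx⟩ : ∃ R : X →L[ℝ] X, ∀ x, R x = S.adjoint (P (S x)) :=
    ⟨S.adjoint ∘L P ∘L S, fun _ => rfl⟩
  obtain ⟨N, hNx⟩ : ∃ N : X →L[ℝ] X, ∀ x, N x = S.adjoint (M (S x)) + C x :=
    ⟨S.adjoint ∘L M ∘L S + C, fun _ => rfl⟩
  have hRi : ∀ x y, ⟪R x, y⟫_ℝ = ⟪P (S x), S y⟫_ℝ := fun x y => by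
    rw [hRx, ContinuousLinearMap.adjoint_inner_left]
  have hR : ∀ x y, ⟪R x, y⟫_ℝ = ⟪x, R y⟫_ℝ := fun x y => by
    rw [hRi, hP, hRx y, ContinuousLinearMap.adjoint_inner_right]
  have hN0 : ∀ x, c * ‖x‖ ^ 2 ≤ ⟪N x, x⟫_ℝ := fun x => by
    rw [hNx, inner_add_left, ContinuousLinearMap.adjoint_inner_left]
    linarith [hM0 (S x), hC x]
  obtain ⟨z, hz⟩ := exists_integrated_solution hT.le hR (fun x => by rw [hRi]; exact hP0 _)
    hc hN0 hQ hQ0 hp.toLp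
  refine ⟨z, Lp.memLp z, ?_⟩
  rw [primL_toLp hp] at hz
  have hpz := coeFn_primL (primL X T z)
  rw [prim_congr (coeFn_primL z)] at hpz
  filter_upwards [Lp.coeFn_add (R.compLpL 2 (vol T) z + N.compLpL 2 (vol T) (primL X T z))
      (Q.compLpL 2 (vol T) (primL X T (primL X T z))),
    Lp.coeFn_add (R.compLpL 2 (vol T) z) (N.compLpL 2 (vol T) (primL X T z)),
    R.coeFn_compLpL z, N.coeFn_compLpL (primL X T z), Q.coeFn_compLpL (primL X T (primL X T z)),
    coeFn_primL z, hpz, (prim_memLp hp).coeFn_toLp] with t a1 a2 a3 a4 a5 a6 a7 a8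
  have h2 : _ = ((prim_memLp hp).toLp _ : Lp X 2 (vol T)) t := congrArg
    (fun f : Lp X 2 (vol T) => f t) hz
  rw [a1, Pi.add_apply, a2, Pi.add_apply, a3, a4, a5, a6, a7, a8,
    show prim T (fun t => γ t • e) t = prim T γ t • e from
      (map_prim (ContinuousLinearMap.toSpanSingleton ℝ e) (integrable_vol_of_memLp hγ) t).symm]
    at h2
  rw [← h2, map_add, hRx, hNx]
  abel

/-- The difference of the two sides is (d/k)(a - kb/(2d))². Below, d = ‖e‖² + 1 and k = κ₀. -/
theorem mul_le_young {a b d k : ℝ} (hd : 0 < d) (hk : 0 < k) :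
    a * b ≤ d / k * a ^ 2 + k / (4 * d) * b ^ 2 := by
  have h : d / k * a ^ 2 + k / (4 * d) * b ^ 2 - a * b
      = (d / k) * (a - k / (2 * d) * b) ^ 2 := by field_simp; ring
  have h2 : 0 ≤ (d / k) * (a - k / (2 * d) * b) ^ 2 := by positivity
  linarith

/-- The energy estimate obtained by testing the evolution equation with the time derivative. -/
theorem energy_estimate {T : ℝ} (hT : 0 < T) {S P M Q C : X →L[ℝ] X}
    {ρ₀ : ℝ} (hρ₀ : 0 ≤ ρ₀) (hP : ∀ x, ρ₀ * ‖x‖ ^ 2 ≤ ⟪P x, x⟫_ℝ)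
    (hM : ∀ x y, ⟪M x, y⟫_ℝ = ⟪x, M y⟫_ℝ) (hM0 : ∀ x, 0 ≤ ⟪M x, x⟫_ℝ)
    {r₁ : ℝ} (hQ : ∀ x, ‖Q x‖ ≤ r₁ * ‖x‖)
    (hC' : ∀ x y, ⟪C x, y⟫_ℝ = ⟪x, C y⟫_ℝ)
    {κ₀ : ℝ} (hκ₀ : 0 < κ₀) (hC : ∀ x, κ₀ * ‖x‖ ^ 2 ≤ ⟪C x, x⟫_ℝ)
    {e : X} {a D K : ℝ} (ha : ‖e‖ ^ 2 = a) (hD : D = a + 1) (hK0 : 0 ≤ K)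
    (hK1 : D / κ₀ * (1 + T) ≤ κ₀ * K / 4)
    (hK2 : D / κ₀ * r₁ ^ 2 * T + κ₀ * a / (4 * D) + r₁ ≤ κ₀ * K / 4)
    {γ : ℝ → ℝ} (hγ : MemLp γ 2 (vol T)) {z : ℝ → X} (hz : MemLp z 2 (vol T))
    (heq : ∀ᵐ t ∂(vol T),
      S.adjoint (P (S (z t)) + M (S (prim T z t))) + Q (prim T (prim T z) t) + C (prim T z t)
        = prim T γ t • e) :
    ρ₀ * ∫ t, ‖S (z t)‖ ^ 2 ∂(vol T) ≤
      κ₀ * K / 4 * (Real.exp (K * T) * ∫ t, γ t ^ 2 ∂(vol T)) := by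
  have iz := integrable_vol_of_memLp hz
  have iγ := integrable_vol_of_memLp hγ
  set y := prim T z with hy
  set v := prim T y with hv
  set h := prim T γ with hh
  have cy : Continuous y := continuous_prim iz
  have my : MemLp y 2 (vol T) := prim_memLp hz
  have iy := integrable_vol_of_memLp my
  have mv : MemLp v 2 (vol T) := prim_memLp my
  have mh : MemLp h 2 (vol T) := prim_memLp hγ
  have ha0 : 0 ≤ a := ha ▸ sq_nonneg _
  have hDpos : 0 < D := by linarith
  have iSz : Integrable (fun s => ρ₀ * ‖S (z s)‖ ^ 2) (vol T) :=
    (integrable_norm_sq (S.comp_memLp' hz)).const_mul _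
  have iγ2 : Integrable (fun s => γ s ^ 2) (vol T) := hγ.integrable_sq
  have iN : Integrable (fun s => ‖y s‖ ^ 2) (vol T) := integrable_norm_sq my
  have iM : Integrable (fun s => ⟪M (S (y s)), S (z s)⟫_ℝ) (vol T) :=
    integrable_inner (M.comp_memLp' (S.comp_memLp' my)) (S.comp_memLp' hz)
  have iC : Integrable (fun s => ⟪C (y s), z s⟫_ℝ) (vol T) :=
    integrable_inner (C.comp_memLp' my) hz
  have iQ : Integrable (fun s => ⟪Q (v s), z s⟫_ℝ) (vol T) :=
    integrable_inner (Q.comp_memLp' mv) hz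
  have iQy : Integrable (fun s => ⟪Q (y s), y s⟫_ℝ) (vol T) :=
    integrable_inner (Q.comp_memLp' my) my
  have mey : MemLp (fun s => ⟪e, y s⟫_ℝ) 2 (vol T) := (innerSL ℝ e).comp_memLp' my
  have mez : MemLp (fun s => ⟪e, z s⟫_ℝ) 2 (vol T) := (innerSL ℝ e).comp_memLp' hz
  have iey : Integrable (fun s => γ s * ⟪e, y s⟫_ℝ) (vol T) := hγ.integrable_mul mey
  have iez : Integrable (fun s => h s * ⟪e, z s⟫_ℝ) (vol T) := mh.integrable_mul mez
  set G := ∫ t, γ t ^ 2 ∂(vol T) with hG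
  have hG0 : 0 ≤ G := integral_nonneg fun s => sq_nonneg _
  set Y : ℝ → ℝ := prim T (fun s => ‖y s‖ ^ 2) with hY
  have e_sq : ∀ x, ⟪e, x⟫_ℝ ^ 2 ≤ a * ‖x‖ ^ 2 := fun x => by
    rw [← ha, ← mul_pow, ← sq_abs]
    exact pow_le_pow_left₀ (abs_nonneg _) (abs_real_inner_le_norm e x) 2
  -- the main inequality
  have main : ∀ t ∈ Icc 0 T, prim T (fun s => ρ₀ * ‖S (z s)‖ ^ 2) t + κ₀ / 4 * ‖y t‖ ^ 2
      ≤ κ₀ * K / 4 * (G + Y t) := by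
    intro t ht
    have hY0 : 0 ≤ Y t := prim_nonneg (fun s => sq_nonneg _) ht.1
    -- energy inequality
    have E1 : prim T (fun s => ρ₀ * ‖S (z s)‖ ^ 2) t
        + prim T (fun s => ⟪M (S (y s)), S (z s)⟫_ℝ) t + prim T (fun s => ⟪C (y s), z s⟫_ℝ) t
        + prim T (fun s => ⟪Q (v s), z s⟫_ℝ) t ≤ prim T (fun s => h s * ⟪e, z s⟫_ℝ) t := by
      have j1 : Integrable (fun s => ρ₀ * ‖S (z s)‖ ^ 2 + ⟪M (S (y s)), S (z s)⟫_ℝ) (vol T) :=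
        iSz.add iM
      have j2 : Integrable (fun s => ρ₀ * ‖S (z s)‖ ^ 2 + ⟪M (S (y s)), S (z s)⟫_ℝ
        + ⟪C (y s), z s⟫_ℝ) (vol T) := j1.add iC
      have j3 : Integrable (fun s => ρ₀ * ‖S (z s)‖ ^ 2 + ⟪M (S (y s)), S (z s)⟫_ℝ
        + ⟪C (y s), z s⟫_ℝ + ⟪Q (v s), z s⟫_ℝ) (vol T) := j2.add iQ
      rw [← prim_add iSz iM, ← prim_add j1 iC, ← prim_add j2 iQ]
      refine prim_mono j3 iez ?_ ht.1
      filter_upwards [heq] with s hs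
      have h3 := congrArg (fun x => ⟪x, z s⟫_ℝ) hs
      simp only [inner_add_left, ContinuousLinearMap.adjoint_inner_left, real_inner_smul_left]
        at h3
      linarith [hP (S (z s))]
    have hSy : ∀ s, S (y s) = prim T (fun s => S (z s)) s := map_prim S iz
    have EM : 0 ≤ prim T (fun s => ⟪M (S (y s)), S (z s)⟫_ℝ) t := by
      have h1 := inner_clm_prim M (S.integrable_comp iz) (S.integrable_comp iz) ht.1
      simp only [← hSy] at h1
      have h2 : (fun s => ⟪M (S (z s)), S (y s)⟫_ℝ) = fun s => ⟪M (S (y s)), S (z s)⟫_ℝ :=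
        funext fun s => by rw [hM, real_inner_comm]
      rw [h2] at h1
      linarith [hM0 (S (y t))]
    have EC : κ₀ / 2 * ‖y t‖ ^ 2 ≤ prim T (fun s => ⟪C (y s), z s⟫_ℝ) t := by
      have h1 := inner_clm_prim C iz iz ht.1
      simp only [← hy] at h1
      have h2 : (fun s => ⟪C (z s), y s⟫_ℝ) = fun s => ⟪C (y s), z s⟫_ℝ :=
        funext fun s => by rw [hC', real_inner_comm]
      rw [h2] at h1
      linarith [hC (y t)]
    have EQ := inner_clm_prim Q iy iz ht.1
    simp only [← hy, ← hv] at EQ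
    have Eh : h t * ⟪e, y t⟫_ℝ = prim T (fun s => γ s * ⟪e, y s⟫_ℝ) t
        + prim T (fun s => h s * ⟪e, z s⟫_ℝ) t := by
      have h1 := bilin_prim_prim (ContinuousLinearMap.mul ℝ ℝ) iγ
        ((innerSL ℝ e).integrable_comp iz) ht.1
      simp only [← map_prim (innerSL ℝ e) iz] at h1
      exact h1
    -- bounds of the right-hand side
    have B1 : h t * ⟪e, y t⟫_ℝ ≤ D / κ₀ * (T * G) + κ₀ / (4 * D) * (a * ‖y t‖ ^ 2) := by
      have h1 : h t ^ 2 ≤ T * G := by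
        have := norm_prim_sq_le hγ ht
        rw [← prim_eq_setIntegral ht] at this
        simp only [Real.norm_eq_abs, sq_abs] at this
        refine this.trans (mul_le_mul ht.2 ?_ (prim_nonneg (fun s => sq_nonneg _) ht.1) hT.le)
        exact (prim_le_prim_right iγ2 (fun s => sq_nonneg _) ht).trans_eq (prim_right hT.le _)
      refine (mul_le_young hDpos hκ₀).trans (add_le_add ?_ ?_)
      · exact mul_le_mul_of_nonneg_left h1 (by positivity)
      · exact mul_le_mul_of_nonneg_left (e_sq _) (by positivity)
    have B2 : -⟪Q (v t), y t⟫_ℝ ≤ D / κ₀ * (r₁ ^ 2 * (T * Y t)) + κ₀ / (4 * D) * ‖y t‖ ^ 2 := by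
      have h1 : ‖v t‖ ^ 2 ≤ T * Y t := by
        have := norm_prim_sq_le my ht
        rw [← prim_eq_setIntegral ht] at this
        exact this.trans (mul_le_mul_of_nonneg_right ht.2 hY0)
      have h2 : -⟪Q (v t), y t⟫_ℝ ≤ (r₁ * ‖v t‖) * ‖y t‖ :=
        (neg_le_abs _).trans ((abs_real_inner_le_norm _ _).trans
          (mul_le_mul_of_nonneg_right (hQ _) (norm_nonneg _)))
      refine h2.trans ((mul_le_young hDpos hκ₀).trans (add_le_add ?_ le_rfl))
      rw [mul_pow]
      exact mul_le_mul_of_nonneg_left (mul_le_mul_of_nonneg_left h1 (sq_nonneg _)) (by positivity)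
    have B3 : -prim T (fun s => γ s * ⟪e, y s⟫_ℝ) t ≤ D / κ₀ * G + κ₀ / (4 * D) * (a * Y t) := by
      have j1 : Integrable (fun s => (D / κ₀) • γ s ^ 2) (vol T) := iγ2.const_mul (D / κ₀)
      have j2 : Integrable (fun s => (κ₀ / (4 * D) * a) • ‖y s‖ ^ 2) (vol T) :=
        iN.const_mul (κ₀ / (4 * D) * a)
      have j3 : Integrable (fun s => (-1 : ℝ) • (γ s * ⟪e, y s⟫_ℝ)) (vol T) := iey.const_mul (-1)
      have h1 : prim T (fun s => (-1 : ℝ) • (γ s * ⟪e, y s⟫_ℝ)) t ≤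
          prim T (fun s => (D / κ₀) • γ s ^ 2 + (κ₀ / (4 * D) * a) • ‖y s‖ ^ 2) t := by
        have j12 : Integrable (fun s => (D / κ₀) • γ s ^ 2 + (κ₀ / (4 * D) * a) • ‖y s‖ ^ 2)
          (vol T) := j1.add j2
        refine prim_mono j3 j12 (Filter.Eventually.of_forall fun s => ?_) ht.1
        have h2 := mul_le_young (a := -γ s) (b := ⟪e, y s⟫_ℝ) hDpos hκ₀
        have h3 := mul_le_mul_of_nonneg_left (e_sq (y s)) (by positivity : 0 ≤ κ₀ / (4 * D))
        simp only [smul_eq_mul]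
        rw [neg_sq] at h2
        linarith
      rw [prim_add j1 j2, prim_smul, prim_smul, prim_smul] at h1
      simp only [smul_eq_mul] at h1
      have h4 := prim_le_prim_right iγ2 (fun s => sq_nonneg _) ht
      rw [prim_right hT.le] at h4
      have h5 := mul_le_mul_of_nonneg_left h4 (by positivity : 0 ≤ D / κ₀)
      linarith
    have B4 : prim T (fun s => ⟪Q (y s), y s⟫_ℝ) t ≤ r₁ * Y t := by
      rw [hY, ← smul_eq_mul, ← prim_smul]
      refine prim_mono iQy (iN.const_mul r₁) (Filter.Eventually.of_forall fun s => ?_) ht.1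
      refine (real_inner_le_norm _ _).trans ?_
      rw [sq, ← mul_assoc]
      exact mul_le_mul_of_nonneg_right (hQ _) (norm_nonneg _)
    -- `hK1` collects the coefficients of G from `B1` and `B3`, `hK2` those of Y from `B2`, `B3` and
    -- `B4`. As D = a + 1, the ‖y t‖² terms of `B1` and `B2` add up to exactly κ₀/4, half of what
    -- `EC` provides.
    have c1 := mul_le_mul_of_nonneg_right hK1 hG0
    have c2 := mul_le_mul_of_nonneg_right hK2 hY0
    have c3 : κ₀ / (4 * D) * (a * ‖y t‖ ^ 2) + κ₀ / (4 * D) * ‖y t‖ ^ 2 = κ₀ / 4 * ‖y t‖ ^ 2 := by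
      rw [hD]; rw [hD] at hDpos; field_simp
    have c4 : κ₀ / (4 * D) * (a * Y t) = κ₀ * a / (4 * D) * Y t := by ring
    linarith
  -- Gronwall
  have hYd : ∀ t ∈ Ico 0 T, HasDerivWithinAt (fun t => G + Y t) (‖y t‖ ^ 2) (Ici t) t := by
    exact fun t ht => (hasDerivWithinAt_prim (cy.norm.pow 2) ht).const_add G
  have hY0 : ∀ t ∈ Icc 0 T, 0 ≤ Y t := fun t ht => prim_nonneg (fun s => sq_nonneg _) ht.1
  -- Since Y' = ‖y‖², this is the differential inequality (G + Y)' ≤ K (G + Y) with initial value G.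
  have hpos : ∀ t ∈ Icc 0 T, ‖y t‖ ^ 2 ≤ K * (G + Y t) := by
    intro t ht
    have h1 := main t ht
    have h2 : 0 ≤ prim T (fun s => ρ₀ * ‖S (z s)‖ ^ 2) t :=
      prim_nonneg (fun s => by positivity) ht.1
    have h3 : κ₀ / 4 * ‖y t‖ ^ 2 ≤ κ₀ / 4 * (K * (G + Y t)) := by linarith
    exact le_of_mul_le_mul_left h3 (by positivity)
  have hgr := norm_le_gronwallBound_of_norm_deriv_right_le (f := fun t => G + Y t)
    (f' := fun t => ‖y t‖ ^ 2) (δ := G) (K := K) (ε := 0) (a := 0) (b := T)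
    (continuous_const.add (continuous_prim iN)).continuousOn hYd
    (by simp [hY, abs_of_nonneg hG0]) (fun t ht => by
      have ht' : t ∈ Icc 0 T := ⟨ht.1, ht.2.le⟩
      rw [Real.norm_of_nonneg (sq_nonneg _), Real.norm_of_nonneg (by linarith [hY0 t ht']),
        add_zero]
      exact hpos t ht') T ⟨hT.le, le_rfl⟩
  rw [gronwallBound_ε0, sub_zero, Real.norm_of_nonneg (by linarith [hY0 T ⟨hT.le, le_rfl⟩])] at hgr
  have hfin := main T ⟨hT.le, le_rfl⟩
  rw [prim_right hT.le, integral_const_mul] at hfin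
  have h1 : κ₀ * K / 4 * (G + Y T) ≤ κ₀ * K / 4 * (Real.exp (K * T) * G) :=
    mul_le_mul_of_nonneg_left (by linarith) (by positivity)
  have h2 : 0 ≤ κ₀ / 4 * ‖y T‖ ^ 2 := by positivity
  linarith

end Evolution

/-! ### Regularity in space, through a linear ODE in H⁴. -/

section Regularity

/-- Regularity of the linear equation `F₁ + c F₀ = q`, `F₀ = ∫F₁`, in a smaller space. -/
theorem exists_regular_solution {X Y : Type*} [NormedAddCommGroup X] [NormedSpace ℝ X]
    [CompleteSpace X] [NormedAddCommGroup Y] [NormedSpace ℝ Y] [CompleteSpace Y]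
    {T : ℝ} (j : Y →L[ℝ] X) (c : X →L[ℝ] X) (c' : Y →L[ℝ] Y) (hc : ∀ y, j (c' y) = c (j y))
    {q : ℝ → Y} (hq : Continuous q) {F : ℝ → X} (hF : Continuous F)
    (heq : ∀ t ∈ Icc 0 T, F t + c (prim T F t) = j (q t)) :
    ∃ Φ₀ Φ₁ : ℝ → Y, Continuous Φ₀ ∧ Continuous Φ₁ ∧
      (∀ t ∈ Icc 0 T, j (Φ₀ t) = prim T F t) ∧ ∀ t ∈ Icc 0 T, j (Φ₁ t) = F t := by
  let ex : ℝ → Y →L[ℝ] Y := fun t => NormedSpace.exp (t • c')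
  have hex : ∀ t, HasDerivAt ex (c' * ex t) t := fun t => hasDerivAt_exp_smul_const' c' t
  have hexc : Continuous ex := continuous_iff_continuousAt.2 fun t => (hex t).continuousAt
  let : NormedAlgebra ℚ (Y →L[ℝ] Y) := NormedAlgebra.restrictScalars ℚ ℝ _
  have hinv : ∀ t y, ex (-t) (ex t y) = y := fun t y => by
    have h : ex (-t) * ex t = 1 := by
      change NormedSpace.exp ((-t) • c') * NormedSpace.exp (t • c') = 1
      rw [← NormedSpace.exp_add_of_commute, ← add_smul, neg_add_cancel, zero_smul,
        NormedSpace.exp_zero]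
      exact (Commute.refl c').smul_left _ |>.smul_right _
    exact DFunLike.congr_fun h y
  have hm : Continuous fun s => ex s (q s) := hexc.clm_apply hq
  let w : ℝ → Y := fun t => ∫ s in (0 : ℝ)..t, ex s (q s)
  have hw : ∀ t, HasDerivAt w (ex t (q t)) t := fun t =>
    intervalIntegral.integral_hasDerivAt_right (hm.intervalIntegrable _ _)
      (hm.stronglyMeasurableAtFilter _ _) hm.continuousAt
  -- Variation of constants, carried out in the smaller space Y: Φ' + c'Φ = q with Φ(0) = 0. Its
  -- image in X solves the same ODE as ∫F, so the two agree.
  let Φ : ℝ → Y := fun t => ex (-t) (w t)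
  have hΦ : ∀ t, HasDerivAt Φ (q t - c' (Φ t)) t := fun t => by
    have h1 : HasDerivAt (fun t => ex (-t)) (-(c' * ex (-t))) t := by
      have h0 := (hex (-t)).scomp t (hasDerivAt_neg t)
      rw [neg_one_smul] at h0
      exact h0
    have h2 := h1.clm_apply (hw t)
    rw [hinv] at h2
    convert h2 using 1
    change q t - c' (Φ t) = -(c' (ex (-t) (w t))) + q t
    rw [sub_eq_neg_add]
  have hΦc : Continuous Φ := continuous_iff_continuousAt.2 fun t => (hΦ t).continuousAt
  have hpF : Continuous (prim T F) := continuous_prim (integrable_vol_of_continuous hF)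
  have huniq : EqOn (fun t => j (Φ t)) (prim T F) (Icc 0 T) := by
    refine ODE_solution_unique_of_mem_Icc_right (v := fun t x => j (q t) - c x)
      (s := fun _ => univ) (K := ‖c‖₊) (fun t _ => ?_) (j.continuous.comp hΦc).continuousOn
      (fun t _ => ?_) (fun _ _ => mem_univ _) hpF.continuousOn (fun t ht => ?_)
      (fun _ _ => mem_univ _) ?_
    · exact LipschitzOnWith.of_dist_le_mul fun x _ y _ => by
        rw [dist_sub_left, dist_eq_norm, dist_eq_norm, ← map_sub]; exact c.le_opNorm _
    · have := j.hasFDerivAt.comp_hasDerivAt t (hΦ t)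
      rw [map_sub, hc] at this
      exact this.hasDerivWithinAt
    · have := hasDerivWithinAt_prim hF ht
      rwa [← heq t ⟨ht.1, ht.2.le⟩, add_sub_cancel_right]
    · simp [Φ, w]
  refine ⟨Φ, fun t => q t - c' (Φ t), hΦc, hq.sub (c'.continuous.comp hΦc), huniq, fun t ht => ?_⟩
  have h1 : j (Φ t) = prim T F t := huniq ht
  rw [map_sub, hc, h1, ← heq t ht, add_sub_cancel_right]

/-- Integrating the evolution equation in time. -/
theorem prim_evolution {X : Type*} [NormedAddCommGroup X] [InnerProductSpace ℝ X]
    [CompleteSpace X] {T : ℝ} {S P M Q C : X →L[ℝ] X} {e : X} {γ : ℝ → ℝ} {f f' f'' : ℝ → X}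
    (hγ : Integrable γ (vol T)) (hf : Integrable f (vol T)) (hf' : Integrable f' (vol T))
    (hf'' : Integrable f'' (vol T))
    (h : ∀ᵐ t ∂(vol T), S.adjoint (P (S (f'' t)) + M (S (f' t))) + Q (f t) + C (f' t) = γ t • e)
    (t : ℝ) :
    S.adjoint (P (S (prim T f'' t)) + M (S (prim T f' t))) + Q (prim T f t) + C (prim T f' t)
      = prim T γ t • e := by
  obtain ⟨R, hR⟩ : ∃ R : X →L[ℝ] X, ∀ x, R x = S.adjoint (P (S x)) :=
    ⟨S.adjoint ∘L P ∘L S, fun _ => rfl⟩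
  obtain ⟨N, hN⟩ : ∃ N : X →L[ℝ] X, ∀ x, N x = S.adjoint (M (S x)) + C x :=
    ⟨S.adjoint ∘L M ∘L S + C, fun _ => rfl⟩
  have hsplit : ∀ x y z, S.adjoint (P (S x) + M (S y)) + Q z + C y = R x + N y + Q z := by
    intro x y z; rw [map_add, hR, hN]; abel
  simp only [hsplit] at h ⊢
  have i1 : Integrable (fun s => R (f'' s)) (vol T) := R.integrable_comp hf''
  have i2 : Integrable (fun s => N (f' s)) (vol T) := N.integrable_comp hf'
  have i3 : Integrable (fun s => Q (f s)) (vol T) := Q.integrable_comp hf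
  have i12 : Integrable (fun s => R (f'' s) + N (f' s)) (vol T) := i1.add i2
  rw [map_prim R hf'', map_prim N hf', map_prim Q hf, ← prim_add i1 i2, ← prim_add i12 i3,
    prim_congr h]
  exact (map_prim (ContinuousLinearMap.toSpanSingleton ℝ e) hγ t).symm

theorem hasWeakDeriv_clm_prim {E F : Type} [NormedAddCommGroup E] [NormedSpace ℝ E]
    [CompleteSpace E] [NormedAddCommGroup F] [NormedSpace ℝ F] [CompleteSpace F] {T : ℝ}
    (hT : 0 ≤ T) (A : E →L[ℝ] F) {f : ℝ → E} (hf : Integrable f (vol T)) :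
    HasWeakDeriv 1 T (fun t => A (prim T f t)) (fun t => A (f t)) := by
  simp only [map_prim A hf]
  exact hasWeakDeriv_prim hT (A.integrable_comp hf)

theorem Sob.mulOp {L : ℝ} (hL : 0 < L) {m : ℕ} (hm : 1 ≤ m) {c : L2 L} (hc : MemLp c ∞ (vol L))
    (hcm : Sob L m c) {f : L2 L} (hf : Sob L m f) : Sob L m (mulOp hc f) :=
  hf.mul hL (by rwa [max_eq_left hm])
    ((coeFn_mulOp hc f).trans (Filter.Eventually.of_forall fun _ => mul_comm _ _))

/-- The second derivative in space of a solution is, at each time, in `H⁴`. -/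
theorem exists_sobolev_regularity {L T : ℝ} (hL : 0 < L) {ρ μ r κ : L2 L}
    (hρ : MemLp ρ ∞ (vol L)) (hμ : MemLp μ ∞ (vol L)) (hr : MemLp r ∞ (vol L))
    (hκ : MemLp κ ∞ (vol L)) (sρ : Sob L 2 ρ) (sμ : Sob L 2 μ) (sr : Sob L 4 r) (sκ : Sob L 4 κ)
    {κ₀ : ℝ} (hκ₀ : 0 < κ₀) (hκb : ∀ᵐ x ∂(vol L), κ₀ ≤ κ x)
    {γ : ℝ → ℝ} (hγ : Continuous γ) {F : ℝ → L2 L} (hF : Continuous F)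
    (heq1 : ∀ t, (dprim L).adjoint (mulOp hρ (dprim L (prim T F t))
        + mulOp hμ (dprim L (prim T (prim T F) t))) + mulOp hr (prim T (prim T (prim T F)) t)
        + mulOp hκ (prim T (prim T F) t) = prim T (prim T γ) t • tipL L)
    (heq2 : ∀ t, (dprim L).adjoint (mulOp hρ (dprim L (F t))
        + mulOp hμ (dprim L (prim T F t))) + mulOp hr (prim T (prim T F) t)
        + mulOp hκ (prim T F t) = prim T γ t • tipL L) :
    ∃ Φ₀ Φ₁ Φ₂ : ℝ → H 4 L, Continuous Φ₀ ∧ Continuous Φ₁ ∧ Continuous Φ₂ ∧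
      (∀ t ∈ Icc 0 T, dx (Φ₀ t) 0 = prim T (prim T (prim T F)) t) ∧
      (∀ t ∈ Icc 0 T, dx (Φ₁ t) 0 = prim T (prim T F) t) ∧
      ∀ t ∈ Icc 0 T, dx (Φ₂ t) 0 = prim T F t := by
  have hinv : MemLp (fun x => (κ x)⁻¹) ∞ (vol L) := by
    refine memLp_top_of_bound (Lp.memLp κ).1.inv₀ κ₀⁻¹ ?_
    filter_upwards [hκb] with x h
    rw [Real.norm_eq_abs, abs_inv, abs_of_pos (hκ₀.trans_le h)]
    exact inv_anti₀ hκ₀ h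
  obtain ⟨k, hk⟩ : ∃ k : L2 L, k =ᵐ[vol L] fun x => (κ x)⁻¹ := by
    have : MemLp (fun x => (κ x)⁻¹) 2 (vol L) := hinv.mono_exponent le_top
    exact ⟨this.toLp, this.coeFn_toLp⟩
  have hkt : MemLp k ∞ (vol L) := hinv.ae_eq hk.symm
  have sk : Sob L 4 k := sκ.inv hL hκ₀ hκb hk
  have hkκ : ∀ f, mulOp hkt (mulOp hκ f) = f := fun f => Lp.ext <| by
    filter_upwards [coeFn_mulOp hkt (mulOp hκ f), coeFn_mulOp hκ f, hk, hκb] with x h1 h2 h3 h4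
    rw [h1, h2, h3, inv_mul_cancel_left₀ (hκ₀.trans_le h4).ne']
  -- the operators of the equation, lifted to `H⁴`
  have hlift : ∀ {σ : L2 L} (hσ : MemLp σ ∞ (vol L)), Sob L 2 σ → ∃ A : L2 L →L[ℝ] H 4 L, ∀ f,
      dx (A f) 0 = mulOp hkt ((dprim L).adjoint (mulOp hσ (dprim L f))) := by
    intro σ hσ sσ
    obtain ⟨A, hA⟩ := exists_lift hL 4
      (mulOp hkt ∘L (dprim L).adjoint ∘L mulOp hσ ∘L dprim L) fun f =>
        Sob.mulOp hL (by norm_num) hkt sk (Sob.adjoint_dprim hL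
          (Sob.mulOp hL (by norm_num) hσ sσ (Sob.dprim (m := 0) trivial)))
    exact ⟨A, hA⟩
  obtain ⟨A, hA⟩ := hlift hρ sρ
  obtain ⟨B, hB⟩ := hlift hμ sμ
  obtain ⟨c', hc'⟩ := exists_lift hL 4 (mulOp hkt ∘L mulOp hr ∘L dxL 4 L 0) fun v =>
    Sob.mulOp hL (by norm_num) hkt sk (Sob.mulOp hL (by norm_num) hr sr (sob_dx hL v))
  obtain ⟨e', he'⟩ := (sob_iff hL).1
    (Sob.mulOp hL (by norm_num : 1 ≤ 4) hkt sk (sob_tipL hL 4))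
  -- Division by κ isolates y + (r/κ) w. The remaining terms lie in H⁴ because S* is the outermost
  -- operator in x and y and gains two derivatives over the H² coefficients.
  have key : ∀ {x y w : L2 L} {a : ℝ}, (dprim L).adjoint (mulOp hρ (dprim L x)
      + mulOp hμ (dprim L y)) + mulOp hr w + mulOp hκ y = a • tipL L →
      y + mulOp hkt (mulOp hr w) = dxL 4 L 0 (a • e' - A x - B y) := by
    intro x y w a h
    have h1 := congrArg (mulOp hkt) h
    simp only [map_add, hkκ, map_smul] at h1
    simp only [map_sub, map_smul, dxL_apply, hA, hB, he', ← h1]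
    abel
  -- In the application F, F₂ and F₁ are u_xxttt, u_xxtt and u_xxt.
  set F₂ := prim T F with hF₂
  set F₁ := prim T F₂ with hF₁
  have cF₂ : Continuous F₂ := continuous_prim (integrable_vol_of_continuous hF)
  have cF₁ : Continuous F₁ := continuous_prim (integrable_vol_of_continuous cF₂)
  have cγ₁ : Continuous (prim T γ) := continuous_prim (integrable_vol_of_continuous hγ)
  have cγ₂ : Continuous (prim T (prim T γ)) := continuous_prim (integrable_vol_of_continuous cγ₁)
  have hq : Continuous fun t => prim T (prim T γ) t • e' - A (F₂ t) - B (F₁ t) :=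
    ((cγ₂.smul continuous_const).sub (A.continuous.comp cF₂)).sub (B.continuous.comp cF₁)
  have hq' : Continuous fun t => prim T γ t • e' - A (F t) - B (F₂ t) :=
    ((cγ₁.smul continuous_const).sub (A.continuous.comp hF)).sub (B.continuous.comp cF₂)
  obtain ⟨Φ₀, Φ₁, c0, c1, h0, h1⟩ := exists_regular_solution (T := T) (dxL 4 L 0)
    (mulOp hkt ∘L mulOp hr) c' hc' hq cF₁ fun t _ => key (heq1 t)
  -- No second ODE is needed: the differentiated equation expresses F₂ through terms already known
  -- to lie in H⁴, among them (r/κ) F₁.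
  refine ⟨Φ₀, Φ₁, fun t => prim T γ t • e' - A (F t) - B (F₂ t) - c' (Φ₁ t), c0, c1,
    hq'.sub (c'.continuous.comp c1), h0, h1, fun t ht => ?_⟩
  have h2 := key (heq2 t)
  have h3 : dxL 4 L 0 (c' (Φ₁ t)) = mulOp hkt (mulOp hr (F₁ t)) := by
    rw [dxL_apply, hc', ← h1 t ht]; rfl
  rw [← dxL_apply, map_sub, ← h2, h3, add_sub_cancel_right]

end Regularity

/-! ### Application to the beam equation. -/

section Solution

/-- The assumptions on the coefficients of the beam equation. -/
structure Coefficients (ℓ ρ₀ r₁ κ₀ : ℝ) (ρ μ r κ : L2 ℓ) : Prop where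
  memLp_ρ : MemLp ρ ∞ (vol ℓ)
  memLp_μ : MemLp μ ∞ (vol ℓ)
  memLp_r : MemLp r ∞ (vol ℓ)
  memLp_κ : MemLp κ ∞ (vol ℓ)
  ρ₀_pos : 0 < ρ₀
  κ₀_pos : 0 < κ₀
  le_ρ : ∀ᵐ x ∂(vol ℓ), ρ₀ ≤ ρ x
  le_μ : ∀ᵐ x ∂(vol ℓ), 0 ≤ μ x
  le_r : ∀ᵐ x ∂(vol ℓ), 0 ≤ r x
  r_le : ∀ᵐ x ∂(vol ℓ), r x ≤ r₁
  le_κ : ∀ᵐ x ∂(vol ℓ), κ₀ ≤ κ x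

theorem inner_mulOp_nonneg {L : ℝ} {c : ℝ → ℝ} (hc : MemLp c ∞ (vol L))
    (h : ∀ᵐ x ∂(vol L), 0 ≤ c x) (f : L2 L) : 0 ≤ ⟪mulOp hc f, f⟫_ℝ := by
  simpa using le_inner_mulOp hc h f

variable {ℓ T ρ₀ r₁ κ₀ : ℝ} {ρ μ r κ : L2 ℓ}

/-- `z` is `u_xxtttt` for the solution `u` with input `g`, `g''' = γ`, expressed through the
equation satisfied by `u_tt`; the lower time derivatives are the iterated primitives of `z`. -/
def IsSolutionData (T : ℝ) (c : Coefficients ℓ ρ₀ r₁ κ₀ ρ μ r κ) (γ : ℝ → ℝ)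
    (z : ℝ → L2 ℓ) : Prop :=
  MemLp z 2 (vol T) ∧ ∀ᵐ t ∂(vol T),
    (dprim ℓ).adjoint (mulOp c.memLp_ρ (dprim ℓ (z t)) + mulOp c.memLp_μ (dprim ℓ (prim T z t)))
      + mulOp c.memLp_r (prim T (prim T z) t) + mulOp c.memLp_κ (prim T z t)
        = prim T γ t • tipL ℓ

theorem exists_isSolutionData (hT : 0 < T) (c : Coefficients ℓ ρ₀ r₁ κ₀ ρ μ r κ)
    {γ : ℝ → ℝ} (hγ : MemLp γ 2 (vol T)) : ∃ z, IsSolutionData T c γ z :=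
  exists_evolution_solution hT (mulOp_comm c.memLp_ρ)
    (inner_mulOp_nonneg c.memLp_ρ (c.le_ρ.mono fun _ h => c.ρ₀_pos.le.trans h))
    (inner_mulOp_nonneg c.memLp_μ c.le_μ) (mulOp_comm c.memLp_r)
    (inner_mulOp_nonneg c.memLp_r c.le_r) c.κ₀_pos (le_inner_mulOp c.memLp_κ c.le_κ) (tipL ℓ) hγ

theorem IsSolutionData.equation_once {c : Coefficients ℓ ρ₀ r₁ κ₀ ρ μ r κ} {γ : ℝ → ℝ}
    {z : ℝ → L2 ℓ} (h : IsSolutionData T c γ z) (hγ : MemLp γ 2 (vol T)) (t : ℝ) :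
    (dprim ℓ).adjoint (mulOp c.memLp_ρ (dprim ℓ (prim T z t))
        + mulOp c.memLp_μ (dprim ℓ (prim T (prim T z) t)))
      + mulOp c.memLp_r (prim T (prim T (prim T z)) t) + mulOp c.memLp_κ (prim T (prim T z) t)
        = prim T (prim T γ) t • tipL ℓ :=
  prim_evolution (integrable_vol_of_memLp (prim_memLp hγ))
    (integrable_vol_of_memLp (prim_memLp (prim_memLp h.1)))
    (integrable_vol_of_memLp (prim_memLp h.1)) (integrable_vol_of_memLp h.1) h.2 t

theorem IsSolutionData.equation_twice {c : Coefficients ℓ ρ₀ r₁ κ₀ ρ μ r κ} {γ : ℝ → ℝ}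
    {z : ℝ → L2 ℓ} (h : IsSolutionData T c γ z) (hγ : MemLp γ 2 (vol T)) (t : ℝ) :
    (dprim ℓ).adjoint (mulOp c.memLp_ρ (dprim ℓ (prim T (prim T z) t))
        + mulOp c.memLp_μ (dprim ℓ (prim T (prim T (prim T z)) t)))
      + mulOp c.memLp_r (prim T (prim T (prim T (prim T z))) t)
      + mulOp c.memLp_κ (prim T (prim T (prim T z)) t)
        = prim T (prim T (prim T γ)) t • tipL ℓ :=
  prim_evolution (integrable_vol_of_memLp (prim_memLp (prim_memLp hγ)))
    (integrable_vol_of_memLp (prim_memLp (prim_memLp (prim_memLp h.1))))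
    (integrable_vol_of_memLp (prim_memLp (prim_memLp h.1)))
    (integrable_vol_of_memLp (prim_memLp h.1))
    (Filter.Eventually.of_forall (h.equation_once hγ)) t

theorem inL2V_clamped {N : L2 ℓ →L[ℝ] H 2 ℓ} (hN : ∀ f, N f ∈ V12 ℓ) {F : ℝ → L2 ℓ}
    (hF : MemLp F 2 (vol T)) : InL2V T fun t => N (F t) :=
  ⟨N.comp_memLp' hF, Filter.Eventually.of_forall fun _ => hN _⟩

/-- The second derivative u_xx is the fourfold time primitive of z, so zero initial values are
automatic and the variational equation is the twice integrated equation for z. -/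
theorem IsSolutionData.exists_isWeakSolution (hℓ : 0 < ℓ) (hT : 0 < T)
    {c : Coefficients ℓ ρ₀ r₁ κ₀ ρ μ r κ} {γ g : ℝ → ℝ} {z : ℝ → L2 ℓ}
    (h : IsSolutionData T c γ z) (hγ : MemLp γ 2 (vol T))
    (hg : g =ᵐ[vol T] prim T (prim T (prim T γ))) :
    ∃ u : ℝ → H 2 ℓ, IsWeakSolution ℓ T ρ μ r κ g u := by
  obtain ⟨N, hN⟩ := exists_clamped hℓ
  have m3 := prim_memLp h.1
  have m2 := prim_memLp m3
  have m1 := prim_memLp m2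
  have m0 := prim_memLp m1
  have i2 := integrable_vol_of_memLp m2
  have i1 := integrable_vol_of_memLp m1
  have hv : ∀ {f : ℝ → L2 ℓ}, MemLp f 2 (vol T) →
      HasValueAt T (fun t => dx (N (prim T f t)) 0) 0 0 := by
    intro f hf
    simp only [(hN _).1]
    have hc := (dprim ℓ).continuous.comp (continuous_prim (integrable_vol_of_memLp hf))
    have := HasValueAt.of_continuous (L := T) hc Filter.EventuallyEq.rfl 0
    rwa [Function.comp_apply, prim_at_zero, map_zero] at this
  refine ⟨fun t => N (prim T (prim T (prim T (prim T z))) t),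
    inL2V_clamped (fun f => (hN f).2.2) m0, fun t => N (prim T (prim T (prim T z)) t),
    fun t => dprim ℓ (prim T (prim T z) t), inL2V_clamped (fun f => (hN f).2.2) m1,
    ?_, (dprim ℓ).comp_memLp' m2, ?_, ?_, hv m1, hv m2⟩
  · simp only [(hN _).1]
    exact hasWeakDeriv_clm_prim hT.le (dprim ℓ) i1
  · simp only [(hN _).1]
    exact hasWeakDeriv_clm_prim hT.le (dprim ℓ) i2
  · filter_upwards [hg] with t ht
    refine (variational_iff hℓ c.memLp_ρ c.memLp_μ c.memLp_r c.memLp_κ (hN _).2.2 _ _).2 ?_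
    rw [(hN _).2.1, (hN _).2.1, ht]
    exact h.equation_twice hγ t

theorem memLp_dx {m : ℕ} {u : ℝ → H m ℓ} (hu : MemLp u 2 (vol T)) (j : Fin (m + 1)) :
    MemLp (fun t => dx (u t) j) 2 (vol T) :=
  (dxL m ℓ j).comp_memLp' hu

theorem IsSolutionData.ae_eq_of_isWeakSolution (hℓ : 0 < ℓ) (hT : 0 < T)
    {c : Coefficients ℓ ρ₀ r₁ κ₀ ρ μ r κ} {γ g : ℝ → ℝ} {z : ℝ → L2 ℓ}
    (h : IsSolutionData T c γ z) (hγ : MemLp γ 2 (vol T))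
    (hg : g =ᵐ[vol T] prim T (prim T (prim T γ))) {u : ℝ → H 2 ℓ}
    (hu : IsWeakSolution ℓ T ρ μ r κ g u) :
    ∀ᵐ t ∂(vol T), dx (u t) 0 = dprim ℓ (prim T (prim T (prim T (prim T z))) t) := by
  obtain ⟨hu, ut, utt, hut, h1, mutt, h2, heq, v0, v1⟩ := hu
  have m2 := prim_memLp (prim_memLp h.1)
  have m1 := prim_memLp m2
  have i1 := integrable_vol_of_memLp m1
  have i2 := integrable_vol_of_memLp m2
  have mf : MemLp (fun t => dx (ut t) 2) 2 (vol T) := memLp_dx hut.1 2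
  have ef := integrable_vol_of_memLp mf
  have e1 := h1.ae_eq_prim hT (integrable_vol_of_memLp (memLp_dx hu.1 0))
    (integrable_vol_of_memLp (memLp_dx hut.1 0)) v0
  have e2 := h2.ae_eq_prim hT (integrable_vol_of_memLp (memLp_dx hut.1 0))
    (integrable_vol_of_memLp mutt) v1
  have e3 : (fun t => dx (ut t) 0) =ᵐ[vol T] fun t => dprim ℓ (dx (ut t) 2) :=
    hut.2.mono fun t ht => dx_zero_eq_dprim hℓ ht
  -- Time integration of u_t = S u_xxt gives u = S∫u_xxt; injectivity of S removes S.
  have e4 : ∀ᵐ t ∂(vol T), dx (u t) 2 = prim T (fun t => dx (ut t) 2) t := by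
    filter_upwards [hu.2, e1] with t ht ht'
    rw [prim_congr e3, ← map_prim (dprim ℓ) ef, dx_zero_eq_dprim hℓ ht] at ht'
    refine sub_eq_zero.1 (dprim_injective hℓ ?_)
    rw [map_sub, ht', sub_self]
  -- Here d is the difference of the two candidates for u_xxt and q the difference of those for
  -- u_tt, so S d = ∫q.
  have hd := ae_eq_zero_of_homogeneous hT (S := dprim ℓ) (mulOp_comm c.memLp_ρ)
    (inner_mulOp_nonneg c.memLp_ρ (c.le_ρ.mono fun _ h => c.ρ₀_pos.le.trans h))
    (inner_mulOp_nonneg c.memLp_μ c.le_μ) (mulOp_comm c.memLp_r)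
    (inner_mulOp_nonneg c.memLp_r c.le_r) c.κ₀_pos (le_inner_mulOp c.memLp_κ c.le_κ)
    (d := fun t => dx (ut t) 2 - prim T (prim T (prim T z)) t)
    (q := fun t => utt t - dprim ℓ (prim T (prim T z) t)) (mf.sub m1)
    (mutt.sub ((dprim ℓ).comp_memLp' m2)) ?_ ?_
  · have hd' : (fun t => dx (ut t) 2) =ᵐ[vol T] prim T (prim T (prim T z)) :=
      hd.mono fun t ht => sub_eq_zero.1 ht
    filter_upwards [hu.2, e4] with t ht ht'
    rw [dx_zero_eq_dprim hℓ ht, ht', prim_congr hd']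
  · filter_upwards [e2, e3] with t ht ht'
    rw [prim_sub (integrable_vol_of_memLp mutt) ((dprim ℓ).integrable_comp i2), map_sub, ← ht', ht,
      map_prim (dprim ℓ) i2]
  · filter_upwards [heq, hut.2, e4, hg] with t ht hV ht4 hgt
    have a1 := (variational_iff hℓ c.memLp_ρ c.memLp_μ c.memLp_r c.memLp_κ hV _ _).1 ht
    have a2 := h.equation_twice hγ t
    rw [← hgt, ← a1] at a2
    rw [prim_sub ef i1, ← ht4]
    have a3 := sub_eq_zero.2 a2.symm
    rw [← a3]
    simp only [map_sub, map_add]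
    abel

theorem IsSolutionData.energy_estimate (hℓ : 0 < ℓ) (hT : 0 < T)
    {c : Coefficients ℓ ρ₀ r₁ κ₀ ρ μ r κ} {γ : ℝ → ℝ} {z : ℝ → L2 ℓ}
    (h : IsSolutionData T c γ z) (hγ : MemLp γ 2 (vol T)) :
    ∫ t, ‖dprim ℓ (z t)‖ ^ 2 ∂(vol T) ≤ κ₀ * C5sq ℓ T r₁ κ₀ / (4 * ρ₀)
      * Real.exp (C5sq ℓ T r₁ κ₀ * T) * ∫ t, γ t ^ 2 ∂(vol T) := by
  have hκ := c.κ₀_pos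
  have hρ := c.ρ₀_pos
  set K := C5sq ℓ T r₁ κ₀ with hK
  set A := 2 * (1 + T) * (ℓ ^ 3 + 3) / (3 * κ₀) with hA
  set B := κ₀ * ℓ ^ 3 / (2 * (ℓ ^ 3 + 3)) + 2 * r₁ + 2 * T * r₁ ^ 2 * (ℓ ^ 3 + 3) / (3 * κ₀)
    with hB
  -- With a = ‖e‖² = ℓ³/3 and D = ℓ³/3 + 1, the two entries of the maximum in C_5² are twice the
  -- left-hand sides of the conditions `hK1` and `hK2`.
  have hKm : κ₀ * K / 4 = max A B / 2 := by
    rw [hK, C5sq, ← hA, ← hB]; field_simp; ring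
  have hA0 : 0 ≤ A := by positivity
  have hK0 : 0 ≤ K := by
    rw [hK, C5sq, ← hA, ← hB]
    exact mul_nonneg (by positivity) (hA0.trans (le_max_left _ _))
  have hK1 : (ℓ ^ 3 / 3 + 1) / κ₀ * (1 + T) ≤ κ₀ * K / 4 := by
    have : (ℓ ^ 3 / 3 + 1) / κ₀ * (1 + T) = A / 2 := by rw [hA]; field_simp
    rw [hKm, this]
    linarith [le_max_left A B]
  have hK2 : (ℓ ^ 3 / 3 + 1) / κ₀ * r₁ ^ 2 * T
      + κ₀ * (ℓ ^ 3 / 3) / (4 * (ℓ ^ 3 / 3 + 1)) + r₁ ≤ κ₀ * K / 4 := by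
    have : (ℓ ^ 3 / 3 + 1) / κ₀ * r₁ ^ 2 * T
        + κ₀ * (ℓ ^ 3 / 3) / (4 * (ℓ ^ 3 / 3 + 1)) + r₁ = B / 2 := by
      rw [hB]; field_simp; ring
    rw [hKm, this]
    linarith [le_max_right A B]
  have hQ := norm_mulOp_le c.memLp_r (C := r₁) (by
    filter_upwards [c.le_r, c.r_le] with x h1 h2
    rwa [abs_of_nonneg h1])
  have := Beam.energy_estimate hT hρ.le (le_inner_mulOp c.memLp_ρ c.le_ρ)
    (mulOp_comm c.memLp_μ) (inner_mulOp_nonneg c.memLp_μ c.le_μ) hQ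
    (mulOp_comm c.memLp_κ) hκ (le_inner_mulOp c.memLp_κ c.le_κ) (norm_tipL_sq hℓ.le) rfl hK0
    hK1 hK2 hγ h.1 h.2
  rw [mul_comm, ← le_div_iff₀ hρ] at this
  refine this.trans_eq ?_
  field_simp

end Solution

end Beam

end

/-! ### The main theorem. -/

theorem theorem2p3
    (ℓ T : ℝ) (hℓ : 0 < ℓ) (hT : 0 < T)
    (ρ μ : Beam.H 2 ℓ) (r κ : Beam.H 4 ℓ) (g : Beam.H 3 T)
    (ρ₀ ρ₁ μ₀ μ₁ r₀ r₁ κ₀ κ₁ : ℝ)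
    (hρ₀ : 0 < ρ₀) (hρ : ∀ᵐ x ∂(Beam.vol ℓ), ρ₀ ≤ Beam.dx ρ 0 x ∧ Beam.dx ρ 0 x ≤ ρ₁)
    (hμ₀ : 0 ≤ μ₀) (hμ : ∀ᵐ x ∂(Beam.vol ℓ), μ₀ ≤ Beam.dx μ 0 x ∧ Beam.dx μ 0 x ≤ μ₁)
    (hr₀ : 0 < r₀) (hr : ∀ᵐ x ∂(Beam.vol ℓ), r₀ ≤ Beam.dx r 0 x ∧ Beam.dx r 0 x ≤ r₁)
    (hκ₀ : 0 < κ₀) (hκ : ∀ᵐ x ∂(Beam.vol ℓ), κ₀ ≤ Beam.dx κ 0 x ∧ Beam.dx κ 0 x ≤ κ₁)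
    (hg0 : Beam.HasValueAt T (Beam.dx g 0) 0 0)
    (hg1 : Beam.HasValueAt T (Beam.dx g 1) 0 0)
    (hg2 : Beam.HasValueAt T (Beam.dx g 2) 0 0) :
    (∃ u : ℝ → Beam.H 2 ℓ, Beam.IsWeakSolution ℓ T
        (Beam.dx ρ 0) (Beam.dx μ 0) (Beam.dx r 0) (Beam.dx κ 0) (Beam.dx g 0) u) ∧
    ∀ u : ℝ → Beam.H 2 ℓ, Beam.IsWeakSolution ℓ T
        (Beam.dx ρ 0) (Beam.dx μ 0) (Beam.dx r 0) (Beam.dx κ 0) (Beam.dx g 0) u →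
      ∃ u₁ u₂ u₃ u₄ : ℝ → Beam.L2 ℓ,
        Beam.HasWeakDeriv 1 T (fun t => Beam.dx (u t) 0) u₁ ∧
        Beam.HasWeakDeriv 1 T u₁ u₂ ∧
        Beam.HasWeakDeriv 1 T u₂ u₃ ∧
        Beam.HasWeakDeriv 1 T u₃ u₄ ∧
        Beam.MemL2H T 6 (fun t => Beam.dx (u t) 0) ∧
        Beam.MemL2H T 6 u₁ ∧
        Beam.MemL2H T 4 u₂ ∧
        Beam.MemL2V T u₃ ∧
        MemLp u₄ 2 (Beam.vol T) ∧
        ∫ t, ‖u₄ t‖ ^ 2 ∂(Beam.vol T) ≤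
          κ₀ * Beam.C5sq ℓ T r₁ κ₀ / (4 * ρ₀) * Real.exp (Beam.C5sq ℓ T r₁ κ₀ * T) * ‖g‖ ^ 2 := by
  have c : Beam.Coefficients ℓ ρ₀ r₁ κ₀ (Beam.dx ρ 0) (Beam.dx μ 0) (Beam.dx r 0)
      (Beam.dx κ 0) :=
    { memLp_ρ := (Beam.sob_dx hℓ ρ).memLp_top (by norm_num)
      memLp_μ := (Beam.sob_dx hℓ μ).memLp_top (by norm_num)
      memLp_r := (Beam.sob_dx hℓ r).memLp_top (by norm_num)
      memLp_κ := (Beam.sob_dx hℓ κ).memLp_top (by norm_num)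
      ρ₀_pos := hρ₀
      κ₀_pos := hκ₀
      le_ρ := hρ.mono fun _ h => h.1
      le_μ := hμ.mono fun _ h => hμ₀.trans h.1
      le_r := hr.mono fun _ h => hr₀.le.trans h.1
      r_le := hr.mono fun _ h => h.2
      le_κ := hκ.mono fun _ h => h.1 }
  have hγ : MemLp (Beam.dx g 3) 2 (Beam.vol T) := Lp.memLp _
  have e2 : Beam.dx g 2 =ᵐ[Beam.vol T] Beam.prim T (Beam.dx g 3) :=
    (g.hasWeakDeriv 2).ae_eq_prim hT (Beam.integrable_coeFn _) (Beam.integrable_coeFn _) hg2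
  have e1 : Beam.dx g 1 =ᵐ[Beam.vol T] Beam.prim T (Beam.dx g 2) :=
    (g.hasWeakDeriv 1).ae_eq_prim hT (Beam.integrable_coeFn _) (Beam.integrable_coeFn _) hg1
  have e0 : Beam.dx g 0 =ᵐ[Beam.vol T] Beam.prim T (Beam.dx g 1) :=
    (g.hasWeakDeriv 0).ae_eq_prim hT (Beam.integrable_coeFn _) (Beam.integrable_coeFn _) hg0
  have hg : Beam.dx g 0 =ᵐ[Beam.vol T] Beam.prim T (Beam.prim T (Beam.prim T (Beam.dx g 3))) := by
    rwa [Beam.prim_congr e1, Beam.prim_congr e2] at e0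
  obtain ⟨z, hz⟩ := Beam.exists_isSolutionData hT c hγ
  refine ⟨hz.exists_isWeakSolution hℓ hT hγ hg, fun u hu => ?_⟩
  have hu0 := hz.ae_eq_of_isWeakSolution hℓ hT hγ hg hu
  have m3 := Beam.prim_memLp hz.1
  have m2 := Beam.prim_memLp m3
  have m1 := Beam.prim_memLp m2
  obtain ⟨Φ₀, Φ₁, Φ₂, c0, c1, c2, h0, h1, h2⟩ := Beam.exists_sobolev_regularity hℓ c.memLp_ρ
    c.memLp_μ c.memLp_r c.memLp_κ (Beam.sob_dx hℓ ρ) (Beam.sob_dx hℓ μ) (Beam.sob_dx hℓ r)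
    (Beam.sob_dx hℓ κ) hκ₀ c.le_κ
    (Beam.continuous_prim (Beam.integrable_vol_of_memLp hγ))
    (Beam.continuous_prim (Beam.integrable_vol_of_memLp hz.1))
    (hz.equation_twice hγ) (hz.equation_once hγ)
  -- The twofold primitive raises H⁴ to H⁶, and composition of a continuous curve with the bounded
  -- lift is again continuous, hence square integrable in time.
  have hmem : ∀ (m : ℕ), m ≤ 6 → ∀ {Φ : ℝ → Beam.H 4 ℓ} {F : ℝ → Beam.L2 ℓ}, Continuous Φ →
      (∀ t ∈ Icc 0 T, Beam.dx (Φ t) 0 = F t) → Beam.MemL2H T m (fun t => Beam.dprim ℓ (F t)) := by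
    intro m hm Φ F hΦ hF
    obtain ⟨N, hN⟩ := Beam.exists_lift hℓ m (Beam.dprim ℓ ∘L Beam.dxL 4 ℓ 0) fun v =>
      (Beam.Sob.dprim (Beam.sob_dx hℓ v)).mono hm
    refine ⟨fun t => N (Φ t), Beam.memLp_vol_of_continuous (N.continuous.comp hΦ), ?_⟩
    filter_upwards [ae_restrict_mem measurableSet_Ioo] with t ht
    rw [hN, ← hF t (Ioo_subset_Icc_self ht)]
    rfl
  obtain ⟨N, hN⟩ := Beam.exists_clamped hℓ
  refine ⟨fun t => Beam.dprim ℓ (Beam.prim T (Beam.prim T (Beam.prim T z)) t),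
    fun t => Beam.dprim ℓ (Beam.prim T (Beam.prim T z) t),
    fun t => Beam.dprim ℓ (Beam.prim T z t), fun t => Beam.dprim ℓ (z t), ?_,
    Beam.hasWeakDeriv_clm_prim hT.le _ (Beam.integrable_vol_of_memLp m2),
    Beam.hasWeakDeriv_clm_prim hT.le _ (Beam.integrable_vol_of_memLp m3),
    Beam.hasWeakDeriv_clm_prim hT.le _ (Beam.integrable_vol_of_memLp hz.1), ?_,
    hmem 6 le_rfl c1 h1, hmem 4 (by norm_num) c2 h2,
    ⟨_, Beam.inL2V_clamped (fun f => (hN f).2.2) m3, Filter.Eventually.of_forall fun t => (hN _).1⟩,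
    (Beam.dprim ℓ).comp_memLp' hz.1, ?_⟩
  · exact (Beam.hasWeakDeriv_clm_prim hT.le (Beam.dprim ℓ)
      (Beam.integrable_vol_of_memLp m1)).congr (Filter.EventuallyEq.symm hu0)
      Filter.EventuallyEq.rfl
  · obtain ⟨W, hW, hW'⟩ := hmem 6 le_rfl c0 h0
    refine ⟨W, hW, ?_⟩
    filter_upwards [hW', hu0] with t ht ht'
    rw [ht, ht']
  · refine (hz.energy_estimate hℓ hT hγ).trans ?_
    have hK : 0 ≤ Beam.C5sq ℓ T r₁ κ₀ := by
      rw [Beam.C5sq]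
      exact mul_nonneg (by positivity) (le_max_of_le_left (by positivity))
    refine mul_le_mul_of_nonneg_left ?_ (by positivity)
    -- The estimate is in terms of g''' alone, one of the four summands of the H³ norm.
    rw [← Beam.norm_sq_eq_integral_sq, Submodule.coe_norm, PiLp.norm_sq_eq_of_L2]
    exact Finset.single_le_sum (f := fun j => ‖(g : PiLp 2 fun _ : Fin 4 => Beam.L2 T) j‖ ^ 2)
      (fun j _ => sq_nonneg _) (Finset.mem_univ 3)
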